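/- Let $p>1$, $a<b$, and $F(s)=\frac{1}{2p}|s^2-1|^p$. Put $$c_p=\Big(\frac{p}{p-1}\Big)^{\frac{p-1}{p}}\int_{-1}^{1}F(s)^{\frac{p-1}{p}}\,ds,\qquad \lambda_p=2^{1-\frac1p}(p-1)^{-\frac1p},$$ and, for $\varepsilon>0$ and $w\in H^1(a,b)$, $$E_\varepsilon[w]=\int_a^b\Big[\frac{\varepsilon^{p-1}|w'|^p}{p}+\frac{F(w)}{\varepsilon}\Big]dx\in[0,\infty].$$ Let $v:[a,b]\to\{-1,1\}$ be piecewise constant with exactly $N$ jumps, located at $a<h_1<\dots<h_N<b$ (so $v$ changes sign across each $h_i$). Let $r>0$ satisfy $h_i+r<h_{i+1}-r$ for $1\le i<N$, $a\le h_1-r$ and $h_N+r\le b$ (for $N=0$ these conditions are void), and let $A\in(0,r\sqrt2\,\lambda_p)$. For all sufficiently small $\varepsilon>0$ let $u_0^\varepsilon\in H^1(a,b)$, and suppose that $$\lim_{\varepsilon\to0^+}\|u_0^\varepsilon-v\|_{L^1(a,b)}=0$$ and that there is a constant $C>0$, independent of $\varepsilon$, such that for all sufficiently small $\varepsilon>0$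 $$E_\varepsilon[u_0^\varepsilon]\le N c_p+C\exp\Big(-\frac{Ap}{2\varepsilon}\Big).$$ For all sufficiently small $\varepsilon>0$ let $u^\varepsilon$ be a global strong solution of $$u_t=\varepsilon^p\big(|u_x|^{p-2}u_x\big)_x-F'(u)\ \text{ in }(a,b)\times(0,\infty),\qquad u_x(a,t)=u_x(b,t)=0\ (t>0),\qquad u(\cdot,0)=u_0^\varepsilon .$$ This means: $u^\varepsilon$ has a time derivative $u^\varepsilon_t\in L^2((0,T)\times(a,b))$ for every $T>0$, with $u^\varepsilon(\cdot,t)=u_0^\varepsilon+\int_0^t u_t^\varepsilon(\cdot,s)\,ds$ in $L^2(a,b)$ for every $t\ge0$; and for almost every $t>0$ the function $u^\varepsilon(\cdot,t)$ is differentiable on $[a,b]$ with $u^\varepsilon_x(a,t)=u^\varepsilon_x(b,t)=0$, the flux $|u^\varepsilon_x|^{p-2}u^\varepsilon_x$ is absolutely continuous on $[a,b]$, and the equation holds for almost every $x\in(a,b)$. Then, for every $m>0$, $$\lim_{\varepsilon\to0^+}\ \sup_{0\le t\le m\exp(Ap/2\varepsilon)}\|u^\varepsilon(\cdot,t)-v\|_{L^1(a,b)}=0.$$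 -/

import Mathlib

open MeasureTheory Set Filter Topology

noncomputable section

namespace PLaplacian

/-- The double-well potential `F(s) = |s² - 1|^p / (2p)` (critical case `n = p`). -/
def potential (p s : ℝ) : ℝ := |s ^ 2 - 1| ^ p / (2 * p)

/-- The nonlinearity `g ↦ |g|^{p-2} g` of the `p`-Laplacian. -/
def flux (p g : ℝ) : ℝ := |g| ^ (p - 2) * g

/-- `c_p = (p/(p-1))^{(p-1)/p} ∫_{-1}^{1} F(s)^{(p-1)/p} ds`. -/
def minEnergy (p : ℝ) : ℝ :=
  (p / (p - 1)) ^ ((p - 1) / p) * ∫ s in (-1 : ℝ)..1, potential p s ^ ((p - 1) / p)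

/-- `λ_p = 2^{1 - 1/p} (p-1)^{-1/p}`. -/
def lam (p : ℝ) : ℝ := 2 ^ (1 - 1 / p) * (p - 1) ^ (-(1 / p))

/-- The Sobolev space `H¹(a,b)`, each class being represented by its absolutely continuous
representative on `[a,b]`: absolutely continuous functions whose (almost everywhere defined)
derivative is square integrable. -/
def MemH1 (a b : ℝ) (f : ℝ → ℝ) : Prop :=
  AbsolutelyContinuousOnInterval f a b ∧ MemLp (deriv f) 2 (volume.restrict (Ioo a b))

/-- The renormalized energy
`E_ε[f] = ∫_a^b (ε^{p-1} |f'|^p / p + F(f) / ε) dx`, with values in `[0, ∞]`. -/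
def energy (p a b ε : ℝ) (f : ℝ → ℝ) : ENNReal :=
  ∫⁻ x in Ioo a b,
    ENNReal.ofReal (ε ^ (p - 1) * |deriv f x| ^ p / p + potential p (f x) / ε)

/-- The `L¹(a,b)` distance, with values in `[0, ∞]`. -/
def distL1 (a b : ℝ) (f g : ℝ → ℝ) : ENNReal :=
  eLpNorm (fun x => f x - g x) 1 (volume.restrict (Ioo a b))

/-- `v : [a,b] → {-1, 1}` is piecewise constant with jumps located exactly at
`a < h₁ < ⋯ < h_N < b`: with `σ` the value of `v` on the leftmost interval, the value at a point
that is not a jump is `σ` times `(-1)` to the number of jumps to its left. -/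
structure IsStepFunction (a b : ℝ) {N : ℕ} (h : Fin N → ℝ) (v : ℝ → ℝ) : Prop where
  strictMono : StrictMono h
  mem_Ioo : ∀ i, h i ∈ Ioo a b
  values : ∀ x ∈ Icc a b, v x = 1 ∨ v x = -1
  alternates : ∃ σ : ℝ, ∀ x ∈ Icc a b, (∀ i, x ≠ h i) →
    v x = σ * (-1) ^ (Finset.univ.filter (fun i => h i < x)).card

/-- `r > 0` separates the jumps: `h_i + r < h_{i+1} - r`, `a ≤ h_1 - r`, `h_N + r ≤ b`. -/
structure IsSeparation (a b : ℝ) {N : ℕ} (h : Fin N → ℝ) (r : ℝ) : Prop where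
  pos : 0 < r
  gap : ∀ i j, i < j → h i + r < h j - r
  left : ∀ i, a ≤ h i - r
  right : ∀ i, h i + r ≤ b

/-- `u` (written `u t x`) is a global strong solution of
`u_t = ε^p (|u_x|^{p-2} u_x)_x - F'(u)` in `(a,b) × (0,∞)`, `u_x(a,t) = u_x(b,t) = 0`,
`u(x,0) = u₀(x)`: there is a time derivative `ut` of `u`, square integrable on each
`(0,T) × (a,b)`, with `u(t) = u₀ + ∫_0^t ut(s) ds` in `L²(a,b)` for every `t ≥ 0`, and for almost
every `t > 0` the function `u(t)` is differentiable on `[a,b]`, has zero (one-sided) derivatives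
at `a` and `b`, its flux `|u_x|^{p-2} u_x` is absolutely continuous, and the equation holds
almost everywhere in `(a,b)`. -/
def IsNeumannSolution (p a b ε : ℝ) (u₀ : ℝ → ℝ) (u : ℝ → ℝ → ℝ) : Prop :=
  ∃ ut : ℝ → ℝ → ℝ,
    (∀ T > 0, MemLp (Function.uncurry ut) 2
      ((volume.restrict (Ioo 0 T)).prod (volume.restrict (Ioo a b)))) ∧
    (∀ t ≥ 0, ∀ᵐ x ∂(volume.restrict (Ioo a b)), u t x = u₀ x + ∫ s in (0 : ℝ)..t, ut s x) ∧
    (∀ᵐ t ∂(volume.restrict (Ioi (0 : ℝ))),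
      DifferentiableOn ℝ (u t) (Icc a b) ∧
      derivWithin (u t) (Icc a b) a = 0 ∧
      derivWithin (u t) (Icc a b) b = 0 ∧
      AbsolutelyContinuousOnInterval (fun x => flux p (derivWithin (u t) (Icc a b) x)) a b ∧
      ∀ᵐ x ∂(volume.restrict (Ioo a b)),
        ut t x = ε ^ p * deriv (fun y => flux p (derivWithin (u t) (Icc a b) y)) x
          - deriv (potential p) (u t x))

end PLaplacian

end

/-! The equation is the `L²` gradient flow of `ε E_ε`, so a solution moves only by spending energy.
The proof shows that near `v` there is almost none to spend.

Static part (`exists_energy_lower_bound`): every `f` that is `L¹`-close to `v` has energy at least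
`N (c_p - 2 exp(-Ap/(2ε)))`. Let `G` be the primitive of the Modica–Mortola density. Young's
inequality bounds the energy below by the variation of `G ∘ f`, which loses the missing distance
`|G(σ) - G(f)|` to the well `σ`. To recover it, `calibration` uses the weighted distance `(1 -
e)(G(σ) - G(f))`: Young's inequality with parameter `1 - e` leaves the part `1 - (1 - e)^{p/(p-1)}`
of the potential term to pay for `e'`. Near a well `F` is comparable to `|G(σ) - G(f)|`, both of
order `|s - σ|^p`, so `e` may grow exponentially at a rate of order `1/ε`. It equals `1` at the far
end, which removes any boundary condition there, and is exponentially small at the transition.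

Dynamic part (`integral_sq_timeDeriv_le`): `∫∫ u_t² ≤ ε (E[u₀] - M)` while the energy stays above
`M`. It comes from semiconvexity of the energy: each slice satisfies a subgradient inequality
against the slice at time `t - τ`. Summing over steps and letting `τ → 0` avoids differentiating the
energy in time.

By Cauchy–Schwarz the `L¹` displacement up to time `t` is at most the square root of `(b - a) t ∫∫
u_t²`. A continuation argument keeps the solution near `v`; up to time `m exp(Ap/(2ε))` the
exponentials cancel and a displacement of order `√ε` remains. -/

/-! ### Absolutely continuous functions: composition and variation -/

/-- A Lipschitz function of an absolutely continuous function is absolutely continuous. -/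
theorem LipschitzOnWith.comp_absolutelyContinuousOnInterval {f G : ℝ → ℝ} {K : NNReal} {s : Set ℝ}
    {a b : ℝ} (hG : LipschitzOnWith K G s) (hf : AbsolutelyContinuousOnInterval f a b)
    (hs : MapsTo f (uIcc a b) s) : AbsolutelyContinuousOnInterval (fun x => G (f x)) a b := by
  rw [absolutelyContinuousOnInterval_iff] at hf ⊢
  intro ε hε
  obtain ⟨δ, hδ, h⟩ := hf (ε / (K + 1)) (by positivity)
  refine ⟨δ, hδ, fun E hE hlen => ?_⟩
  have h1 := h E hE hlen
  have h2 : ∑ i ∈ Finset.range E.1, dist (G (f (E.2 i).1)) (G (f (E.2 i).2))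
      ≤ ∑ i ∈ Finset.range E.1, (K + 1 : ℝ) * dist (f (E.2 i).1) (f (E.2 i).2) := by
    refine Finset.sum_le_sum fun i hi => ?_
    have hmem := hE.1 i hi
    refine (hG.dist_le_mul _ (hs hmem.1) _ (hs hmem.2)).trans ?_
    have := dist_nonneg (x := f (E.2 i).1) (y := f (E.2 i).2)
    nlinarith
  rw [← Finset.mul_sum] at h2
  rw [lt_div_iff₀ (by positivity)] at h1
  linarith

/-- A `C¹` function of an absolutely continuous function is absolutely continuous. -/
theorem AbsolutelyContinuousOnInterval.comp_of_hasDerivAt {f G g : ℝ → ℝ} {a b : ℝ}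
    (hf : AbsolutelyContinuousOnInterval f a b) (hG : ∀ s, HasDerivAt G (g s) s)
    (hg : Continuous g) : AbsolutelyContinuousOnInterval (fun x => G (f x)) a b := by
  obtain ⟨C, hC⟩ := hf.exists_bound
  obtain ⟨D, hD⟩ := (isCompact_Icc (a := -C) (b := C)).exists_bound_of_continuousOn hg.continuousOn
  have hL : LipschitzOnWith (Real.toNNReal D) G (Icc (-C) C) := by
    refine (convex_Icc _ _).lipschitzOnWith_of_nnnorm_hasDerivWithin_le
      (fun x _ => (hG x).hasDerivWithinAt) fun x hx => ?_
    rw [← NNReal.coe_le_coe, coe_nnnorm]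
    exact (hD x hx).trans (Real.le_coe_toNNReal D)
  refine hL.comp_absolutelyContinuousOnInterval hf fun x hx => ?_
  exact abs_le.1 (hC x hx)

/-- The total variation of an absolutely continuous function bounds its increments. -/
theorem AbsolutelyContinuousOnInterval.ofReal_abs_sub_le_lintegral {f : ℝ → ℝ} {a b : ℝ}
    (hf : AbsolutelyContinuousOnInterval f a b) :
    ENNReal.ofReal |f b - f a| ≤ ∫⁻ x in uIoc a b, ENNReal.ofReal |deriv f x| := by
  rw [← hf.integral_deriv_eq_sub]
  have hi := hf.intervalIntegrable_deriv
  rw [intervalIntegrable_iff] at hi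
  have h1 : |∫ x in a..b, deriv f x| ≤ ∫ x in uIoc a b, |deriv f x| := by
    simpa [Real.norm_eq_abs] using
      intervalIntegral.norm_integral_le_integral_norm_uIoc (f := deriv f) (a := a) (b := b)
        (μ := volume)
  refine (ENNReal.ofReal_le_ofReal h1).trans ?_
  rw [ofReal_integral_eq_lintegral_ofReal hi.abs (ae_of_all _ fun x => abs_nonneg _)]

/-! ### The Modica–Mortola density and inequalities near the wells -/

namespace PLaplacian

/-- The Modica–Mortola density `(p/(p-1))^{(p-1)/p} F^{(p-1)/p}`. -/
noncomputable def mmDensity (p s : ℝ) : ℝ :=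
  (p / (p - 1)) ^ ((p - 1) / p) * potential p s ^ ((p - 1) / p)

/-- The primitive of the Modica–Mortola density vanishing at `0`. -/
noncomputable def mmPrimitive (p s : ℝ) : ℝ := ∫ t in (0 : ℝ)..s, mmDensity p t

variable {p : ℝ}

theorem potential_nonneg (hp : 1 < p) (s : ℝ) : 0 ≤ potential p s := by
  unfold potential; positivity

theorem continuous_potential (hp : 1 < p) : Continuous (potential p) := by
  unfold potential
  refine Continuous.div_const (Continuous.rpow_const (by fun_prop) fun _ => Or.inr (by linarith)) _

theorem mmDensity_nonneg (hp : 1 < p) (s : ℝ) : 0 ≤ mmDensity p s := by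
  have := potential_nonneg hp s
  have : 0 < p - 1 := by linarith
  unfold mmDensity; positivity

theorem continuous_mmDensity (hp : 1 < p) : Continuous (mmDensity p) := by
  unfold mmDensity
  have : 0 < p - 1 := by linarith
  exact continuous_const.mul ((continuous_potential hp).rpow_const fun _ => Or.inr (by positivity))

theorem lam_pos (hp : 1 < p) : 0 < lam p := by
  have : 0 < p - 1 := by linarith
  unfold lam; positivity

/-- The constant `(p-1) λ_p` normalises the density. With it, the ratio of `F` to the scaled
distance `(p-1) λ_p |G(1) - G(s)|` tends to `1` at the well. -/
theorem mmDensity_eq (hp : 1 < p) (s : ℝ) :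
    (p - 1) * lam p * mmDensity p s = |s ^ 2 - 1| ^ (p - 1) := by
  have h1 : 0 < p - 1 := by linarith
  have h0 : 0 < p := by linarith
  have e1 : (p - 1) * lam p = (2 * (p - 1)) ^ ((p - 1) / p) := by
    unfold lam
    rw [Real.mul_rpow (by norm_num) h1.le]
    have : (p - 1) / p = 1 - 1 / p := by field_simp
    rw [this]
    have : (p - 1) ^ (1 - 1 / p) = (p - 1) * (p - 1) ^ (-(1 / p)) := by
      rw [show 1 - 1 / p = 1 + -(1 / p) by ring, Real.rpow_add h1, Real.rpow_one]
    rw [this]; ring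
  rw [e1, mmDensity, potential, ← mul_assoc, ← Real.mul_rpow (by positivity) (by positivity),
    ← Real.mul_rpow (by positivity) (by positivity)]
  have : 2 * (p - 1) * (p / (p - 1)) * (|s ^ 2 - 1| ^ p / (2 * p)) = |s ^ 2 - 1| ^ p := by
    field_simp
  rw [this, ← Real.rpow_mul (abs_nonneg _)]
  congr 1
  field_simp

theorem mmDensity_neg (s : ℝ) : mmDensity p (-s) = mmDensity p s := by
  simp [mmDensity, potential]

theorem hasDerivAt_mmPrimitive (hp : 1 < p) (s : ℝ) :
    HasDerivAt (mmPrimitive p) (mmDensity p s) s :=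
  (continuous_mmDensity hp).integral_hasStrictDerivAt 0 s |>.hasDerivAt

theorem mmPrimitive_sub (hp : 1 < p) (s t : ℝ) :
    mmPrimitive p t - mmPrimitive p s = ∫ x in s..t, mmDensity p x :=
  intervalIntegral.integral_interval_sub_left
    ((continuous_mmDensity hp).intervalIntegrable _ _)
    ((continuous_mmDensity hp).intervalIntegrable _ _)

theorem mmPrimitive_neg (s : ℝ) : mmPrimitive p (-s) = -mmPrimitive p s := by
  unfold mmPrimitive
  have := intervalIntegral.integral_comp_neg (f := mmDensity p) (a := 0) (b := s)
  simp only [mmDensity_neg, neg_zero] at this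
  rw [this, intervalIntegral.integral_symm]

theorem minEnergy_eq (hp : 1 < p) : minEnergy p = mmPrimitive p 1 - mmPrimitive p (-1) := by
  rw [mmPrimitive_sub hp]
  simp [minEnergy, mmDensity]

theorem mmDensity_pos (hp : 1 < p) {s : ℝ} (hs : s ^ 2 ≠ 1) : 0 < mmDensity p s := by
  have h1 := mmDensity_eq hp s
  have h2 : 0 < |s ^ 2 - 1| ^ (p - 1) :=
    Real.rpow_pos_of_pos (abs_pos.2 (sub_ne_zero.2 hs)) _
  rw [← h1] at h2
  have : 0 < (p - 1) * lam p := mul_pos (by linarith) (lam_pos hp)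
  exact pos_of_mul_pos_right h2 this.le

theorem strictMono_mmPrimitive (hp : 1 < p) : StrictMono (mmPrimitive p) := by
  intro s t hst
  rw [← sub_pos, mmPrimitive_sub hp]
  refine intervalIntegral.integral_pos hst (continuous_mmDensity hp).continuousOn
    (fun x _ => mmDensity_nonneg hp x) ?_
  by_cases hs : s ^ 2 = 1
  · by_cases ht : t ^ 2 = 1
    -- Here `s = -1` and `t = 1`, so the density is positive at the intermediate point `0`.
    · refine ⟨0, ⟨?_, ?_⟩, mmDensity_pos hp (by norm_num)⟩
      · nlinarith
      · nlinarith
    · exact ⟨t, ⟨hst.le, le_rfl⟩, mmDensity_pos hp ht⟩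
  · exact ⟨s, ⟨le_rfl, hst.le⟩, mmDensity_pos hp hs⟩

/-- Young's inequality with a parameter `q`. -/
theorem young_energy (hp : 1 < p) {ε q : ℝ} (hε : 0 < ε) (hq : 0 ≤ q) (g s : ℝ) :
    q * (mmDensity p s * |g|) + (1 - q ^ (p / (p - 1))) * (potential p s / ε)
      ≤ ε ^ (p - 1) * |g| ^ p / p + potential p s / ε := by
  have h1 : 0 < p - 1 := by linarith
  have h0 : 0 < p := by linarith
  have hF := potential_nonneg hp s
  have hc : p.HolderConjugate (p / (p - 1)) := Real.HolderConjugate.conjExponent hp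
  have hr : ((p - 1) / p) * (p / (p - 1)) = 1 := by field_simp
  have hr' : ((p - 1) / p) * p = p - 1 := by field_simp
  -- The second factor is scaled so that its conjugate power contributes exactly `q^{p/(p-1)} F/ε`;
  -- the rest of the potential term is kept.
  have hy := Real.young_inequality_of_nonneg (a := ε ^ ((p - 1) / p) * |g|)
    (b := q * (p / (p - 1) * (potential p s / ε)) ^ ((p - 1) / p)) (by positivity) (by positivity) hc
  rw [Real.mul_rpow (x := ε ^ ((p - 1) / p)) (y := |g|) (by positivity) (by positivity),
    Real.mul_rpow (x := q) (y := (p / (p - 1) * (potential p s / ε)) ^ ((p - 1) / p)) hq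
      (by positivity), ← Real.rpow_mul hε.le, ← Real.rpow_mul (by positivity), hr, hr', Real.rpow_one] at hy
  have e1 : ε ^ ((p - 1) / p) * |g| * (q * (p / (p - 1) * (potential p s / ε)) ^ ((p - 1) / p))
      = q * (mmDensity p s * |g|) := by
    unfold mmDensity
    rw [Real.mul_rpow (by positivity) (by positivity), Real.div_rpow hF hε.le]
    have : 0 < ε ^ ((p - 1) / p) := by positivity
    field_simp
  have e2 : q ^ (p / (p - 1)) * (p / (p - 1) * (potential p s / ε)) / (p / (p - 1))
      = q ^ (p / (p - 1)) * (potential p s / ε) := by field_simp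
  rw [e1, e2] at hy
  linarith

theorem abs_mmPrimitive_one_sub_le (hp : 1 < p) {ρ s : ℝ} (hs : |s - 1| ≤ ρ) :
    (p - 1) * lam p * |mmPrimitive p 1 - mmPrimitive p s| ≤ (2 + ρ) ^ (p - 1) * |s - 1| ^ p / p := by
  have h1 : 0 < p - 1 := by linarith
  have h0 : 0 < p := by linarith
  have hK : 0 < (p - 1) * lam p := mul_pos h1 (lam_pos hp)
  have hρ : 0 ≤ ρ := (abs_nonneg _).trans hs
  have hpt : ∀ t, |t - 1| ≤ ρ → (p - 1) * lam p * mmDensity p t ≤ (2 + ρ) ^ (p - 1) * |t - 1| ^ (p - 1) := by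
    intro t ht
    rw [mmDensity_eq hp, show t ^ 2 - 1 = (t + 1) * (t - 1) by ring, abs_mul,
      Real.mul_rpow (abs_nonneg _) (abs_nonneg _)]
    gcongr
    rw [abs_le] at ht ⊢
    constructor <;> linarith
  have hcont : Continuous fun t : ℝ => (2 + ρ) ^ (p - 1) * |t - 1| ^ (p - 1) :=
    continuous_const.mul (Continuous.rpow_const (by fun_prop) fun _ => Or.inr h1.le)
  have hci : ∀ x y : ℝ, IntervalIntegrable (fun t => (p - 1) * lam p * mmDensity p t) volume x y :=
    fun x y => (continuous_const.mul (continuous_mmDensity hp)).intervalIntegrable _ _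
  rw [abs_le] at hs
  rcases le_total s 1 with h | h
  · have e : ∫ t in s..1, (2 + ρ) ^ (p - 1) * |t - 1| ^ (p - 1)
        = (2 + ρ) ^ (p - 1) * (1 - s) ^ p / p := by
      have : ∫ t in s..1, |t - 1| ^ (p - 1) = ∫ t in s..1, (1 - t) ^ (p - 1) := by
        refine intervalIntegral.integral_congr fun t ht => ?_
        rw [uIcc_of_le h] at ht
        simp only [abs_of_nonpos (sub_nonpos.2 ht.2), neg_sub]
      rw [intervalIntegral.integral_const_mul, this,
        intervalIntegral.integral_comp_sub_left (fun t => t ^ (p - 1)) 1,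
        integral_rpow (Or.inl (by linarith))]
      simp [Real.zero_rpow h0.ne']
      ring
    rw [abs_of_nonneg (sub_nonneg.2 _), mmPrimitive_sub hp,
      ← intervalIntegral.integral_const_mul, abs_of_nonpos (by linarith : s - 1 ≤ 0), neg_sub, ← e]
    · refine intervalIntegral.integral_mono_on h (hci _ _) (hcont.intervalIntegrable _ _) ?_
      intro t ht
      exact hpt t (abs_le.2 ⟨by linarith [ht.1], by linarith [ht.2]⟩)
    · rw [← sub_nonneg, mmPrimitive_sub hp]
      exact intervalIntegral.integral_nonneg h fun t _ => mmDensity_nonneg hp t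
  · have e : ∫ t in (1 : ℝ)..s, (2 + ρ) ^ (p - 1) * |t - 1| ^ (p - 1)
        = (2 + ρ) ^ (p - 1) * (s - 1) ^ p / p := by
      have : ∫ t in (1 : ℝ)..s, |t - 1| ^ (p - 1) = ∫ t in (1 : ℝ)..s, (t - 1) ^ (p - 1) := by
        refine intervalIntegral.integral_congr fun t ht => ?_
        rw [uIcc_of_le h] at ht
        simp only [abs_of_nonneg (sub_nonneg.2 ht.1)]
      rw [intervalIntegral.integral_const_mul, this,
        intervalIntegral.integral_comp_sub_right (fun t => t ^ (p - 1)) 1,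
        integral_rpow (Or.inl (by linarith))]
      simp [Real.zero_rpow h0.ne']
      ring
    rw [abs_sub_comm, abs_of_nonneg (sub_nonneg.2 _), mmPrimitive_sub hp,
      ← intervalIntegral.integral_const_mul, abs_of_nonneg (by linarith : 0 ≤ s - 1), ← e]
    · refine intervalIntegral.integral_mono_on h (hci _ _) (hcont.intervalIntegrable _ _) ?_
      intro t ht
      exact hpt t (abs_le.2 ⟨by linarith [ht.1], by linarith [ht.2]⟩)
    · rw [← sub_nonneg, mmPrimitive_sub hp]
      exact intervalIntegral.integral_nonneg h fun t _ => mmDensity_nonneg hp t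

/-- Near a well the potential dominates the Modica–Mortola distance to the well, with a constant
close to the optimal one `(p-1) λ_p`. -/
theorem exists_potential_ge (hp : 1 < p) : ∃ ρ : ℝ, 0 < ρ ∧ ∀ σ : ℝ, (σ = 1 ∨ σ = -1) →
    ∀ s, |s - σ| ≤ ρ →
      9 / 10 * ((p - 1) * lam p) * |mmPrimitive p σ - mmPrimitive p s| ≤ potential p s := by
  have h1 : 0 < p - 1 := by linarith
  have h0 : 0 < p := by linarith
  -- At `ρ = 0` this reads `(9/5) 2^{p-1} < 2^p`; the factor `9/10` leaves room for continuity.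
  have hev : ∀ᶠ ρ in 𝓝 (0 : ℝ), 9 / 5 * (2 + ρ) ^ (p - 1) < (2 - ρ) ^ p := by
    have hl : Tendsto (fun ρ : ℝ => 9 / 5 * (2 + ρ) ^ (p - 1)) (𝓝 0) (𝓝 (9 / 5 * (2 + 0) ^ (p - 1))) :=
      Continuous.tendsto (continuous_const.mul
        (Continuous.rpow_const (by fun_prop) fun _ => Or.inr h1.le)) 0
    have hr : Tendsto (fun ρ : ℝ => (2 - ρ) ^ p) (𝓝 0) (𝓝 ((2 - 0) ^ p)) :=
      Continuous.tendsto (Continuous.rpow_const (by fun_prop) fun _ => Or.inr h0.le) 0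
    refine hl.eventually_lt hr ?_
    have : (2 : ℝ) ^ p = 2 * 2 ^ (p - 1) := by
      rw [Real.rpow_sub_one (by norm_num)]; ring
    have h2 : (0 : ℝ) < 2 ^ (p - 1) := by positivity
    simp only [add_zero, sub_zero, this]
    linarith
  obtain ⟨ρ, hρ, hρ'⟩ := ((hev.filter_mono nhdsWithin_le_nhds).and
    (Ioo_mem_nhdsGT (zero_lt_one (α := ℝ)))).exists
  have key : ∀ s, |s - 1| ≤ ρ →
      9 / 10 * ((p - 1) * lam p) * |mmPrimitive p 1 - mmPrimitive p s| ≤ potential p s := by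
    intro s hs
    have hG := abs_mmPrimitive_one_sub_le hp hs
    have hF : (2 - ρ) ^ p * |s - 1| ^ p / (2 * p) ≤ potential p s := by
      rw [potential, show s ^ 2 - 1 = (s + 1) * (s - 1) by ring, abs_mul,
        Real.mul_rpow (abs_nonneg _) (abs_nonneg _)]
      gcongr
      · linarith [hρ'.2]
      · exact le_trans (by linarith [(abs_le.1 hs).1]) (le_abs_self _)
    refine le_trans ?_ hF
    calc 9 / 10 * ((p - 1) * lam p) * |mmPrimitive p 1 - mmPrimitive p s|
        = 9 / 10 * ((p - 1) * lam p * |mmPrimitive p 1 - mmPrimitive p s|) := by ring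
      _ ≤ 9 / 10 * ((2 + ρ) ^ (p - 1) * |s - 1| ^ p / p) := by gcongr
      _ = 9 / 5 * (2 + ρ) ^ (p - 1) * |s - 1| ^ p / (2 * p) := by field_simp; ring
      _ ≤ _ := by gcongr
  refine ⟨ρ, hρ'.1, fun σ hσ s hs => ?_⟩
  rcases hσ with rfl | rfl
  · exact key s hs
  -- The well `-1` reduces to `1` by reflection: `mmPrimitive` is odd and `potential` is even.
  · have := key (-s) (by rw [← abs_neg]; convert hs using 2; ring)
    have e : |mmPrimitive p (-1) - mmPrimitive p s| = |mmPrimitive p 1 - mmPrimitive p (-s)| := by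
      rw [mmPrimitive_neg, mmPrimitive_neg, ← abs_neg]
      ring_nf
    rw [e]
    simpa [potential] using this

/-- The slope at `e = 0` is `P`. With `P = p/(p-1)` this gives the fast growth rate for small
weights; `le_one_sub_rpow` is the cruder substitute on all of `[0,1]`. -/
theorem exists_one_sub_rpow_ge {P : ℝ} (hP : 1 < P) : ∃ δ : ℝ, 0 < δ ∧ δ ≤ 1 ∧
    ∀ e ∈ Icc 0 δ, 9 / 10 * P * e ≤ 1 - (1 - e) ^ P := by
  have hd : HasDerivAt (fun e : ℝ => 1 - (1 - e) ^ P) P 0 := by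
    have := ((hasDerivAt_id (0 : ℝ)).const_sub 1).rpow_const (p := P) (Or.inr hP.le)
    simpa using this.const_sub 1
  have := hd.tendsto_slope.eventually (lt_mem_nhds (a := 9 / 10 * P) (by linarith))
  rw [eventually_nhdsWithin_iff, Metric.eventually_nhds_iff] at this
  obtain ⟨δ, hδ, h⟩ := this
  refine ⟨min (δ / 2) 1, by positivity, min_le_right _ _, fun e he => ?_⟩
  rcases he.1.eq_or_lt with rfl | h0
  · simp
  · have h2 := h (y := e) (by
      rw [Real.dist_eq, sub_zero, abs_of_pos h0]
      linarith [he.2.trans (min_le_left _ _)]) h0.ne'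
    rw [slope_def_field, lt_div_iff₀ (by linarith)] at h2
    simp at h2
    linarith

theorem le_one_sub_rpow {P e : ℝ} (hP : 1 < P) (he : e ∈ Icc (0 : ℝ) 1) : e ≤ 1 - (1 - e) ^ P := by
  have := Real.rpow_le_rpow_of_exponent_ge' (x := 1 - e) (by linarith [he.2]) (by linarith [he.1])
    zero_le_one hP.le
  rw [Real.rpow_one] at this
  linarith

end PLaplacian

/-! ### Calibrations and the energy on one side of a transition -/

namespace PLaplacian

/-- The renormalized energy on a set `s`. -/
noncomputable def energyOn (p ε : ℝ) (f : ℝ → ℝ) (s : Set ℝ) : ENNReal :=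
  ∫⁻ x in s, ENNReal.ofReal (ε ^ (p - 1) * |deriv f x| ^ p / p + potential p (f x) / ε)

variable {p : ℝ}

theorem energyOn_mono {ε : ℝ} {f : ℝ → ℝ} {s t : Set ℝ} (h : s ⊆ t) :
    energyOn p ε f s ≤ energyOn p ε f t :=
  lintegral_mono_set h

theorem energyOn_union {ε : ℝ} {f : ℝ → ℝ} {s t : Set ℝ} (h : Disjoint s t)
    (ht : MeasurableSet t) : energyOn p ε f (s ∪ t) = energyOn p ε f s + energyOn p ε f t :=
  lintegral_union ht h

theorem energyOn_uIoc_add {ε c d m : ℝ} {f : ℝ → ℝ} (hm : m ∈ uIcc c d) :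
    energyOn p ε f (uIoc c d) = energyOn p ε f (uIoc c m) + energyOn p ε f (uIoc m d) := by
  rcases le_total c d with h | h
  · rw [uIcc_of_le h] at hm
    rw [uIoc_of_le h, uIoc_of_le hm.1, uIoc_of_le hm.2, ← Ioc_union_Ioc_eq_Ioc hm.1 hm.2]
    exact energyOn_union (Ioc_disjoint_Ioc_of_le le_rfl) measurableSet_Ioc
  · rw [uIcc_of_ge h] at hm
    rw [uIoc_of_ge h, uIoc_of_ge hm.1, uIoc_of_ge hm.2, ← Ioc_union_Ioc_eq_Ioc hm.1 hm.2, add_comm]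
    exact energyOn_union (Ioc_disjoint_Ioc_of_le le_rfl) measurableSet_Ioc

/-- A calibration estimate: lower bound for the energy in terms of a weighted
Modica–Mortola distance. -/
theorem calibration (hp : 1 < p) {ε c d σ : ℝ} (hε : 0 < ε) {f e e' : ℝ → ℝ}
    (hf : AbsolutelyContinuousOnInterval f c d)
    (he : ∀ x, HasDerivAt e (e' x) x) (he' : Continuous e')
    (he1 : ∀ x ∈ uIcc c d, e x ≤ 1)
    (hcal : ∀ x ∈ uIcc c d, |e' x| * |mmPrimitive p σ - mmPrimitive p (f x)|
      ≤ (1 - (1 - e x) ^ (p / (p - 1))) * (potential p (f x) / ε)) :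
    ENNReal.ofReal |(1 - e c) * (mmPrimitive p σ - mmPrimitive p (f c))
        - (1 - e d) * (mmPrimitive p σ - mmPrimitive p (f d))|
      ≤ energyOn p ε f (uIoc c d) := by
  have hid : AbsolutelyContinuousOnInterval (fun x : ℝ => x) c d :=
    (LipschitzWith.id.lipschitzOnWith (s := uIcc c d)).absolutelyContinuousOnInterval
  have h1 : AbsolutelyContinuousOnInterval (fun x => 1 - e x) c d :=
    hid.comp_of_hasDerivAt (fun s => (he s).const_sub 1) he'.neg
  have h2 : AbsolutelyContinuousOnInterval (fun x => mmPrimitive p σ - mmPrimitive p (f x)) c d :=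
    hf.comp_of_hasDerivAt (G := fun s => mmPrimitive p σ - mmPrimitive p s)
      (fun s => (hasDerivAt_mmPrimitive hp s).const_sub _) (continuous_mmDensity hp).neg
  have h3 := (h1.fun_mul h2).ofReal_abs_sub_le_lintegral
  rw [abs_sub_comm] at h3
  refine h3.trans (lintegral_mono_ae ?_)
  filter_upwards [ae_restrict_of_ae hf.ae_differentiableAt,
    ae_restrict_mem (measurableSet_uIoc (a := c) (b := d))] with x hx hxm
  have hxm' : x ∈ uIcc c d := uIoc_subset_uIcc hxm
  have hD := ((he x).const_sub 1).mul
    (((hasDerivAt_mmPrimitive hp (f x)).comp x (hx hxm').hasDerivAt).const_sub (mmPrimitive p σ))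
  have hD' : deriv (fun x => (1 - e x) * (mmPrimitive p σ - mmPrimitive p (f x))) x = _ := hD.deriv
  rw [hD']
  refine ENNReal.ofReal_le_ofReal ?_
  -- With `q = 1 - e x`, the remaining share of the potential is what `hcal` compares with the
  -- derivative of the weight.
  have hy := young_energy hp hε (sub_nonneg.2 (he1 x hxm')) (deriv f x) (f x)
  refine le_trans ?_ hy
  refine (abs_add_le _ _).trans ?_
  have := hcal x hxm'
  rw [abs_mul, abs_neg, abs_mul, abs_neg, abs_mul, abs_of_nonneg (sub_nonneg.2 (he1 x hxm')),
    abs_of_nonneg (mmDensity_nonneg hp _), add_comm]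
  exact add_le_add le_rfl this

/-- The Modica–Mortola lower bound. -/
theorem modica_mortola (hp : 1 < p) {ε c d : ℝ} (hε : 0 < ε) {f : ℝ → ℝ}
    (hf : AbsolutelyContinuousOnInterval f c d) :
    ENNReal.ofReal |mmPrimitive p (f d) - mmPrimitive p (f c)| ≤ energyOn p ε f (uIoc c d) := by
  have := calibration hp (σ := 0) (e := fun _ => 0) (e' := fun _ => 0) hε hf
    (fun x => hasDerivAt_const x 0) continuous_const (fun _ _ => zero_le_one)
    (fun x _ => by simp)
  convert this using 3
  ring

/-- The weight is `e₀ exp(-μ |d - x| / ε)`. Since `|e'| = μ e / ε`, the calibration condition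
becomes algebraic in `e` and free of `ε`. The sign `ς` lets the interval run in either direction. -/
theorem calibration_exp (hp : 1 < p) {ε c d σ ς ℓ μ e₀ : ℝ} (hε : 0 < ε) {f : ℝ → ℝ}
    (hς : ς = 1 ∨ ς = -1) (hℓ : 0 ≤ ℓ) (hd : d = c + ς * ℓ) (hμ : 0 ≤ μ) (he₀ : 0 ≤ e₀)
    (he₁ : e₀ ≤ 1) (hf : AbsolutelyContinuousOnInterval f c d)
    (hcal : ∀ x ∈ uIcc c d, ∀ e ∈ Icc 0 e₀, μ * e * |mmPrimitive p σ - mmPrimitive p (f x)|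
      ≤ (1 - (1 - e) ^ (p / (p - 1))) * potential p (f x)) :
    ENNReal.ofReal |(1 - e₀ * Real.exp (-(μ * ℓ / ε))) * (mmPrimitive p σ - mmPrimitive p (f c))
        - (1 - e₀) * (mmPrimitive p σ - mmPrimitive p (f d))|
      ≤ energyOn p ε f (uIoc c d) := by
  have hς2 : ς * ς = 1 := by rcases hς with rfl | rfl <;> norm_num
  have hςa : |ς| = 1 := by rcases hς with rfl | rfl <;> norm_num
  have hpos : ∀ x ∈ uIcc c d, 0 ≤ ς * (d - x) := by
    intro x hx
    rcases hς with rfl | rfl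
    · rw [uIcc_of_le (by linarith)] at hx
      linarith [hx.2]
    · rw [uIcc_of_ge (by linarith)] at hx
      linarith [hx.1]
  have hmem : ∀ x ∈ uIcc c d, e₀ * Real.exp (-(μ * (ς * (d - x)) / ε)) ∈ Icc 0 e₀ := by
    intro x hx
    refine ⟨by positivity, mul_le_of_le_one_right he₀ (Real.exp_le_one_iff.2 ?_)⟩
    have := hpos x hx
    rw [neg_nonpos]
    positivity
  have hder : ∀ x, HasDerivAt (fun x => e₀ * Real.exp (-(μ * (ς * (d - x)) / ε)))
      (μ / ε * ς * (e₀ * Real.exp (-(μ * (ς * (d - x)) / ε)))) x := by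
    intro x
    have h1 : HasDerivAt (fun x => -(μ * (ς * (d - x)) / ε)) (μ / ε * ς) x := by
      exact (((((hasDerivAt_id x).const_sub d).const_mul ς).const_mul μ).div_const ε).neg.congr_deriv
        (by ring)
    exact (h1.exp.const_mul e₀).congr_deriv (by ring)
  have := calibration hp (σ := σ) (e := fun x => e₀ * Real.exp (-(μ * (ς * (d - x)) / ε)))
    (e' := fun x => μ / ε * ς * (e₀ * Real.exp (-(μ * (ς * (d - x)) / ε)))) hε hf
    hder (by fun_prop) (fun x hx => (hmem x hx).2.trans he₁) (fun x hx => ?_)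
  · have hc : ς * (d - c) = ℓ := by rw [hd]; linear_combination ℓ * hς2
    simpa [hc] using this
  · have h1 := hcal x hx _ (hmem x hx)
    have h0 := (hmem x hx).1
    rw [abs_mul, abs_mul, hςa, abs_of_nonneg h0, abs_of_nonneg (by positivity)]
    calc _ = (μ * (e₀ * Real.exp (-(μ * (ς * (d - x)) / ε))) *
          |mmPrimitive p σ - mmPrimitive p (f x)|) / ε := by ring
      _ ≤ _ := by rw [← mul_div_assoc]; gcongr

/-- The Modica–Mortola distance to a well separates points and is continuous. -/
theorem exists_mmPrimitive_gap (hp : 1 < p) {ρ : ℝ} (hρ : 0 < ρ) :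
    ∃ ρ' : ℝ, 0 < ρ' ∧ ∀ σ : ℝ, (σ = 1 ∨ σ = -1) → ∀ t, |t - σ| ≤ ρ' →
      |mmPrimitive p σ - mmPrimitive p t| ≤ 1 ∧ ∀ s, ρ < |s - σ| →
        2 * |mmPrimitive p σ - mmPrimitive p t| ≤ |mmPrimitive p σ - mmPrimitive p s| := by
  have hm := strictMono_mmPrimitive hp
  have hu := hm (show (1 : ℝ) < 1 + ρ by linarith)
  have hl := hm (show (1 : ℝ) - ρ < 1 by linarith)
  -- Half the smaller distance from `G(1)` to `G(1 ± ρ)`, so that points outside the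
  -- `ρ`-neighbourhood are at least `2η` away in the `G`-distance.
  set η := min 1 (min ((mmPrimitive p (1 + ρ) - mmPrimitive p 1) / 2)
    ((mmPrimitive p 1 - mmPrimitive p (1 - ρ)) / 2)) with hη
  have hη0 : 0 < η := lt_min one_pos (lt_min (by linarith) (by linarith))
  have hη1 : η ≤ 1 := min_le_left _ _
  have hη2 : 2 * η ≤ mmPrimitive p (1 + ρ) - mmPrimitive p 1 := by
    linarith [(min_le_right _ _ : η ≤ _).trans (min_le_left _ _)]
  have hη3 : 2 * η ≤ mmPrimitive p 1 - mmPrimitive p (1 - ρ) := by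
    linarith [(min_le_right _ _ : η ≤ _).trans (min_le_right _ _)]
  obtain ⟨δ, hδ, h⟩ := Metric.continuousAt_iff.1 (hasDerivAt_mmPrimitive hp 1).continuousAt η hη0
  have key1 : ∀ t, |t - 1| ≤ δ / 2 → |mmPrimitive p 1 - mmPrimitive p t| ≤ η := by
    intro t ht
    have := h (x := t) (by rw [Real.dist_eq]; linarith)
    rw [Real.dist_eq, abs_sub_comm] at this
    exact this.le
  have key2 : ∀ s, ρ < |s - 1| → 2 * η ≤ |mmPrimitive p 1 - mmPrimitive p s| := by
    intro s hs
    rcases lt_abs.1 hs with h | h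
    · have := hm (show 1 + ρ < s by linarith)
      exact le_abs.2 (Or.inr (by linarith))
    · have := hm (show s < 1 - ρ by linarith)
      exact le_abs.2 (Or.inl (by linarith))
  refine ⟨δ / 2, by positivity, fun σ hσ t ht => ?_⟩
  rcases hσ with rfl | rfl
  · exact ⟨(key1 t ht).trans hη1, fun s hs => by linarith [key1 t ht, key2 s hs]⟩
  · have hneg : ∀ s, |mmPrimitive p (-1) - mmPrimitive p s|
        = |mmPrimitive p 1 - mmPrimitive p (-s)| := by
      intro s
      rw [mmPrimitive_neg, mmPrimitive_neg, ← abs_neg]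
      ring_nf
    have hneg' : ∀ s : ℝ, |s - -1| = |-s - 1| := by
      intro s
      rw [← abs_neg]
      ring_nf
    rw [hneg'] at ht
    simp only [hneg, hneg']
    exact ⟨(key1 _ ht).trans hη1, fun s hs => by linarith [key1 _ ht, key2 _ hs]⟩

/-- Lower bound for the energy on one side of a transition. -/
theorem exists_half_transition_bound (hp : 1 < p) {r A : ℝ} (hr : 0 < r)
    (hA : A < r * Real.sqrt 2 * lam p) :
    ∃ ρ : ℝ, 0 < ρ ∧ ∀ᶠ ε in 𝓝[>] (0 : ℝ), ∀ σ ς : ℝ, (σ = 1 ∨ σ = -1) → (ς = 1 ∨ ς = -1) →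
      ∀ (c d ℓ : ℝ) (f : ℝ → ℝ), 19 / 20 * r ≤ ℓ → d = c + ς * ℓ →
      AbsolutelyContinuousOnInterval f c d → |f c - σ| ≤ ρ →
      ENNReal.ofReal (|mmPrimitive p σ - mmPrimitive p (f c)| - Real.exp (-(A * p / (2 * ε))))
        ≤ energyOn p ε f (uIoc c d) := by
  have h1 : 0 < p - 1 := by linarith
  have hlam := lam_pos hp
  obtain ⟨ρ₀, hρ₀, hreg⟩ := exists_potential_ge hp
  obtain ⟨ρ, hρ, hgap⟩ := exists_mmPrimitive_gap hp hρ₀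
  have hP : 1 < p / (p - 1) := by rw [lt_div_iff₀ h1]; linarith
  obtain ⟨δ, hδ, hδ1, hconv⟩ := exists_one_sub_rpow_ge hP
  set K := (p - 1) * lam p with hK
  have hKpos : 0 < K := mul_pos h1 hlam
  have hθ : ∀ᶠ ε in 𝓝[>] (0 : ℝ), Real.exp (-(9 / 10 * K * (r / 20) / ε)) < δ := by
    have : Tendsto (fun ε : ℝ => 9 / 10 * K * (r / 20) / ε) (𝓝[>] 0) atTop :=
      Tendsto.const_mul_atTop (by positivity) tendsto_inv_nhdsGT_zero
    exact (Real.tendsto_exp_neg_atTop_nhds_zero.comp this).eventually (gt_mem_nhds hδ)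
  refine ⟨ρ, hρ, ?_⟩
  filter_upwards [hθ, self_mem_nhdsWithin] with ε hθδ hε σ ς hσ hς c d ℓ f hℓ hd hf hfc
  replace hε : 0 < ε := hε
  have hℓ0 : 0 < ℓ := by linarith
  obtain ⟨hV1, hV2⟩ := hgap σ hσ (f c) hfc
  -- Either `f` stays near the well, where the calibration applies, or it leaves, and the excursion
  -- alone costs enough.
  by_cases hstay : ∀ x ∈ uIcc c d, |f x - σ| ≤ ρ₀
  · set θ := Real.exp (-(9 / 10 * K * (r / 20) / ε)) with hθdef
    have hθ0 : 0 < θ := Real.exp_pos _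
    -- On the last stretch of length `r/20` the weight falls from `1` to `θ < δ` at the slow rate;
    -- on the rest it is below `δ` and decays at the fast rate.
    set m := c + ς * (ℓ - r / 20) with hm
    have hdm : d = m + ς * (r / 20) := by rw [hd, hm]; ring
    have hmem : m ∈ uIcc c d := by
      rcases hς with rfl | rfl
      · rw [uIcc_of_le (by linarith)]
        constructor <;> linarith
      · rw [uIcc_of_ge (by linarith)]
        constructor <;> linarith
    have hsub1 : uIcc c m ⊆ uIcc c d := uIcc_subset_uIcc left_mem_uIcc hmem
    have hsub2 : uIcc m d ⊆ uIcc c d := uIcc_subset_uIcc hmem right_mem_uIcc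
    have hB := calibration_exp hp (σ := σ) (μ := 81 / 100 * (p / (p - 1)) * K) hε hς
      (by linarith : 0 ≤ ℓ - r / 20) hm (by positivity) hθ0.le (hθδ.le.trans hδ1)
      (hf.mono hsub1) (fun x hx e he => by
        have a1 := hconv e ⟨he.1, he.2.trans hθδ.le⟩
        have a2 := hreg σ hσ (f x) (hstay x (hsub1 hx))
        have a3 : 0 ≤ 9 / 10 * (p / (p - 1)) * e := by have := he.1; positivity
        calc _ = (9 / 10 * (p / (p - 1)) * e) *
              (9 / 10 * K * |mmPrimitive p σ - mmPrimitive p (f x)|) := by ring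
          _ ≤ _ := mul_le_mul a1 a2 (by positivity) (a3.trans a1))
    have hAq := calibration_exp hp (σ := σ) (μ := 9 / 10 * K) (e₀ := 1) hε hς
      (by linarith : 0 ≤ r / 20) hdm (by positivity) zero_le_one le_rfl
      (hf.mono hsub2) (fun x hx e he => by
        have a1 := le_one_sub_rpow hP he
        have a2 := hreg σ hσ (f x) (hstay x (hsub2 hx))
        calc _ = e * (9 / 10 * K * |mmPrimitive p σ - mmPrimitive p (f x)|) := by ring
          _ ≤ _ := mul_le_mul a1 a2 (by positivity) (he.1.trans a1))
    rw [energyOn_uIoc_add hmem]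
    refine le_trans ?_ (add_le_add hB hAq)
    rw [← ENNReal.ofReal_add (abs_nonneg _) (abs_nonneg _)]
    refine ENNReal.ofReal_le_ofReal ?_
    simp only [one_mul, sub_self, zero_mul, sub_zero]
    set E := Real.exp (-(81 / 100 * (p / (p - 1)) * K * (ℓ - r / 20) / ε)) with hE
    have hE0 : 0 < E := Real.exp_pos _
    have hEle : E ≤ Real.exp (-(A * p / (2 * ε))) := by
      refine Real.exp_le_exp.2 (neg_le_neg ?_)
      have e1 : 81 / 100 * (p / (p - 1)) * K * (ℓ - r / 20) / ε
          = (81 / 100 * lam p * (ℓ - r / 20)) * p / ε := by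
        rw [hK]; field_simp
      rw [e1, show A * p / (2 * ε) = A / 2 * p / ε by field_simp]
      -- The three losses leave the factor `(9/10)³ = 0.729`, still above `1.42/2 ≥ √2/2`, the value
      -- required by the bound on `A`.
      have hs : Real.sqrt 2 ≤ 1.42 := Real.sqrt_le_iff.2 ⟨by norm_num, by norm_num⟩
      have : r * Real.sqrt 2 * lam p ≤ r * 1.42 * lam p := by gcongr
      have : 81 / 100 * lam p * (9 / 10 * r) ≤ 81 / 100 * lam p * (ℓ - r / 20) := by
        gcongr; linarith
      have : A / 2 ≤ 81 / 100 * lam p * (ℓ - r / 20) := by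
        nlinarith [mul_pos hr hlam]
      gcongr
    set V := mmPrimitive p σ - mmPrimitive p (f c)
    set W := (1 - θ) * (mmPrimitive p σ - mmPrimitive p (f m))
    have hθ1 : θ ≤ 1 := hθδ.le.trans hδ1
    have hEθ : θ * E ≤ E := mul_le_of_le_one_left hE0.le hθ1
    -- `W` is the boundary term at `m` shared by the two pieces; the triangle inequality eliminates
    -- it.
    have t1 : |(1 - θ * E) * V| ≤ |(1 - θ * E) * V - W| + |W| := by
      simpa using abs_add_le ((1 - θ * E) * V - W) W
    have t2 : |V| - |θ * E * V| ≤ |(1 - θ * E) * V| := by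
      have := abs_sub_abs_le_abs_sub V (θ * E * V)
      rwa [show V - θ * E * V = (1 - θ * E) * V by ring] at this
    have t3 : |θ * E * V| ≤ E := by
      rw [abs_mul, abs_of_nonneg (by positivity)]
      exact (mul_le_of_le_one_right (by positivity) hV1).trans hEθ
    exact le_trans (by linarith) t1
  · push Not at hstay
    obtain ⟨x, hx, hfx⟩ := hstay
    have hsub : uIcc c x ⊆ uIcc c d := uIcc_subset_uIcc left_mem_uIcc hx
    have := modica_mortola hp hε (hf.mono hsub)
    rw [energyOn_uIoc_add hx]
    refine (ENNReal.ofReal_le_ofReal ?_).trans (this.trans le_self_add)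
    -- Leaving the neighbourhood at least doubles the `G`-distance to the well, so the increment of
    -- `G ∘ f` already dominates the distance at `c`.
    have a1 := hV2 _ hfx
    have a2 := abs_sub_abs_le_abs_sub (mmPrimitive p σ - mmPrimitive p (f x))
      (mmPrimitive p σ - mmPrimitive p (f c))
    rw [sub_sub_sub_cancel_left, abs_sub_comm (mmPrimitive p (f c))] at a2
    linarith [Real.exp_pos (-(A * p / (2 * ε)))]

end PLaplacian

/-! ### Energy lower bound near a step function -/

namespace PLaplacian

variable {p a b : ℝ} {N : ℕ} {h : Fin N → ℝ} {v : ℝ → ℝ} {r : ℝ}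

/-- A step function takes constant opposite values on the two sides of a jump. -/
theorem IsStepFunction.exists_sign (hv : IsStepFunction a b h v) (hr : IsSeparation a b h r)
    (i : Fin N) : ∃ σ : ℝ, (σ = 1 ∨ σ = -1) ∧ (∀ x ∈ Ioo (h i) (h i + r), v x = σ) ∧
      ∀ x ∈ Ioo (h i - r) (h i), v x = -σ := by
  obtain ⟨s, hs⟩ := hv.alternates
  have hr0 := hr.pos
  have hI := hv.mem_Ioo i
  have hle := hr.left i
  have hri := hr.right i
  have hsep : ∀ j, j < i → h j < h i - r := fun j hj => by linarith [hr.gap j i hj]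
  have hsep' : ∀ j, i < j → h i + r < h j := fun j hj => by linarith [hr.gap i j hj]
  have hR : ∀ x ∈ Ioo (h i) (h i + r), v x = s * (-1) ^ (Finset.Iic i).card := by
    intro x hx
    rw [hs x ⟨by linarith [hx.1], by linarith [hx.2]⟩ ?_]
    · congr 3
      ext j
      simp only [Finset.mem_filter, Finset.mem_univ, true_and, Finset.mem_Iic]
      constructor
      · intro hj
        by_contra hc
        linarith [hsep' j (not_le.1 hc), hx.2]
      · intro hj
        exact (hv.strictMono.monotone hj).trans_lt hx.1
    · rintro j rfl
      rcases lt_trichotomy j i with hj | hj | hj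
      · linarith [hsep j hj, hx.1]
      · subst hj; exact lt_irrefl _ hx.1
      · linarith [hsep' j hj, hx.2]
  have hL : ∀ x ∈ Ioo (h i - r) (h i), v x = s * (-1) ^ (Finset.Iio i).card := by
    intro x hx
    rw [hs x ⟨by linarith [hx.1], by linarith [hx.2]⟩ ?_]
    · congr 3
      ext j
      simp only [Finset.mem_filter, Finset.mem_univ, true_and, Finset.mem_Iio]
      constructor
      · intro hj
        by_contra hc
        linarith [hv.strictMono.monotone (not_lt.1 hc), hx.2]
      · intro hj
        linarith [hsep j hj, hx.1]
    · rintro j rfl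
      rcases lt_trichotomy j i with hj | hj | hj
      · linarith [hsep j hj, hx.1]
      · subst hj; exact lt_irrefl _ hx.2
      · linarith [hsep' j hj, hx.2]
  -- Crossing `h i` adds exactly one jump to the count, hence one change of sign.
  have hcard : (Finset.Iic i).card = (Finset.Iio i).card + 1 := by
    simp
  refine ⟨s * (-1) ^ (Finset.Iic i).card, ?_, hR, fun x hx => ?_⟩
  · rw [← hR (h i + r / 2) ⟨by linarith, by linarith⟩]
    exact hv.values _ ⟨by linarith, by linarith⟩
  · rw [hL x hx, hcard, pow_succ]; ring

/-- If `f` is `L¹`-close to `v`, it is pointwise close to `v` somewhere in each long interval. -/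
theorem exists_abs_sub_le_of_distL1 {c d ρ δ : ℝ} {f : ℝ → ℝ} (hsub : Ioo c d ⊆ Ioo a b)
    (hcd : c < d) (hρ : 0 < ρ) (hf : distL1 a b f v ≤ ENNReal.ofReal δ) (hδ : δ < ρ * (d - c)) :
    ∃ x ∈ Ioo c d, |f x - v x| ≤ ρ := by
  by_contra hcon
  push Not at hcon
  have h1 : ∫⁻ _ in Ioo c d, ENNReal.ofReal ρ ≤ ∫⁻ x in Ioo c d, ‖f x - v x‖ₑ := by
    refine setLIntegral_mono' measurableSet_Ioo fun x hx => ?_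
    rw [Real.enorm_eq_ofReal_abs]
    exact ENNReal.ofReal_le_ofReal (hcon x hx).le
  rw [setLIntegral_const, Real.volume_Ioo, ← ENNReal.ofReal_mul hρ.le] at h1
  rw [distL1, eLpNorm_one_eq_lintegral_enorm] at hf
  have h2 := h1.trans ((lintegral_mono_set hsub).trans hf)
  rw [ENNReal.ofReal_le_ofReal_iff'] at h2
  have : 0 < ρ * (d - c) := mul_pos hρ (by linarith)
  rcases h2 with h2 | h2 <;> linarith

theorem energy_eq_energyOn_Ioc {ε : ℝ} {f : ℝ → ℝ} :
    energy p a b ε f = energyOn p ε f (Ioc a b) := by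
  rw [energyOn, ← restrict_Ioo_eq_restrict_Ioc]
  rfl

/-- Exponentially sharp lower bound for the energy of functions close to a step function. -/
theorem exists_energy_lower_bound (hp : 1 < p) (hab : a < b) (hv : IsStepFunction a b h v)
    (hr : IsSeparation a b h r) {A : ℝ} (hA : A < r * Real.sqrt 2 * lam p) :
    ∃ δ : ℝ, 0 < δ ∧ ∀ᶠ ε in 𝓝[>] (0 : ℝ), ∀ f : ℝ → ℝ, AbsolutelyContinuousOnInterval f a b →
      distL1 a b f v ≤ ENNReal.ofReal δ →
      ENNReal.ofReal (N * (minEnergy p - 2 * Real.exp (-(A * p / (2 * ε)))))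
        ≤ energy p a b ε f := by
  have hr0 := hr.pos
  obtain ⟨ρ, hρ, hev⟩ := exists_half_transition_bound hp hr0 hA
  -- Below `ρ · r/20`, so each window of length `r/20` beside a jump contains a point where `f` is
  -- `ρ`-close to `v`; at least `19r/20` then remains to the outer endpoint.
  refine ⟨ρ * (r / 40), by positivity, ?_⟩
  filter_upwards [hev, self_mem_nhdsWithin] with ε hhalf hε f hf hfv
  replace hε : 0 < ε := hε
  have hjump : ∀ i, ENNReal.ofReal (minEnergy p - 2 * Real.exp (-(A * p / (2 * ε))))
      ≤ energyOn p ε f (Ioc (h i - r) (h i + r)) := by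
    intro i
    obtain ⟨σ, hσ, hR, hL⟩ := hv.exists_sign hr i
    have hle := hr.left i
    have hri := hr.right i
    obtain ⟨y, hy, hfy⟩ := exists_abs_sub_le_of_distL1 (c := h i) (d := h i + r / 20)
      (Ioo_subset_Ioo (by linarith) (by linarith)) (by linarith) hρ hfv (by nlinarith)
    obtain ⟨x, hx, hfx⟩ := exists_abs_sub_le_of_distL1 (c := h i - r / 20) (d := h i)
      (Ioo_subset_Ioo (by linarith) (by linarith)) (by linarith) hρ hfv (by nlinarith)
    rw [hR y ⟨hy.1, by linarith [hy.2]⟩] at hfy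
    rw [hL x ⟨by linarith [hx.1], hx.2⟩] at hfx
    have hsub : ∀ s t : ℝ, s ∈ Icc (h i - r) (h i + r) → t ∈ Icc (h i - r) (h i + r) →
        AbsolutelyContinuousOnInterval f s t := by
      intro s t hs ht
      refine hf.mono (uIcc_subset_uIcc ?_ ?_) <;> rw [uIcc_of_le hab.le]
      · exact ⟨by linarith [hs.1], by linarith [hs.2]⟩
      · exact ⟨by linarith [ht.1], by linarith [ht.2]⟩
    have hx1 := hx.1
    have hx2 := hx.2
    have hy1 := hy.1
    have hy2 := hy.2
    have bR := hhalf σ 1 hσ (Or.inl rfl) y (h i + r) (h i + r - y) f (by linarith) (by ring)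
      (hsub _ _ ⟨by linarith, by linarith⟩ ⟨by linarith, by linarith⟩) hfy
    have bL := hhalf (-σ) (-1) (by rcases hσ with rfl | rfl <;> norm_num) (Or.inr rfl) x (h i - r)
      (x - (h i - r)) f (by linarith) (by ring)
      (hsub _ _ ⟨by linarith, by linarith⟩ ⟨by linarith, by linarith⟩) hfx
    have bM := modica_mortola hp hε (c := x) (d := y)
      (hsub _ _ ⟨by linarith, by linarith⟩ ⟨by linarith, by linarith⟩)
    have hsum : energyOn p ε f (Ioc (h i - r) (h i + r))
        = energyOn p ε f (uIoc x (h i - r)) + (energyOn p ε f (uIoc x y)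
          + energyOn p ε f (uIoc y (h i + r))) := by
      have hxy : x ∈ uIcc (h i - r) (h i + r) := by
        rw [uIcc_of_le (by linarith)]; exact ⟨by linarith, by linarith⟩
      have hyx : y ∈ uIcc x (h i + r) := by
        rw [uIcc_of_le (by linarith)]; exact ⟨by linarith, by linarith⟩
      rw [← energyOn_uIoc_add hyx, uIoc_comm x (h i - r), ← energyOn_uIoc_add hxy,
        uIoc_of_le (by linarith)]
    rw [hsum]
    refine le_trans ?_ (add_le_add bL (add_le_add bM bR))
    refine le_trans ?_ (add_le_add le_rfl ENNReal.ofReal_add_le)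
    refine le_trans ?_ ENNReal.ofReal_add_le
    refine ENNReal.ofReal_le_ofReal ?_
    have hc : minEnergy p = |mmPrimitive p σ - mmPrimitive p (-σ)| := by
      have : mmPrimitive p (-1) ≤ mmPrimitive p 1 :=
        (strictMono_mmPrimitive hp).monotone (by norm_num)
      rw [minEnergy_eq hp]
      rcases hσ with rfl | rfl
      · rw [abs_of_nonneg (by linarith)]
      · rw [neg_neg, abs_sub_comm, abs_of_nonneg (by linarith)]
    rw [hc]
    -- The transition between `x` and `y` and the two side contributions add up to the full distance
    -- `|G(σ) - G(-σ)| = c_p`.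
    have t1 := abs_sub_le (mmPrimitive p σ) (mmPrimitive p (f y)) (mmPrimitive p (-σ))
    have t2 := abs_sub_le (mmPrimitive p (f y)) (mmPrimitive p (f x)) (mmPrimitive p (-σ))
    rw [abs_sub_comm (mmPrimitive p (f x))] at t2
    linarith
  have hdisj : Pairwise (Function.onFun Disjoint fun i => Ioc (h i - r) (h i + r)) := by
    have hlt : ∀ i j, i < j → Disjoint (Ioc (h i - r) (h i + r)) (Ioc (h j - r) (h j + r)) :=
      fun i j hij => Ioc_disjoint_Ioc_of_le (hr.gap i j hij).le
    intro i j hij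
    rcases lt_or_gt_of_ne hij with hlt' | hlt'
    · exact hlt i j hlt'
    · exact (hlt j i hlt').symm
  calc ENNReal.ofReal (N * (minEnergy p - 2 * Real.exp (-(A * p / (2 * ε)))))
      = ∑ _i : Fin N, ENNReal.ofReal (minEnergy p - 2 * Real.exp (-(A * p / (2 * ε)))) := by
        rw [ENNReal.ofReal_mul (Nat.cast_nonneg _)]
        simp
    _ ≤ ∑ i, energyOn p ε f (Ioc (h i - r) (h i + r)) := Finset.sum_le_sum fun i _ => hjump i
    _ = energyOn p ε f (⋃ i, Ioc (h i - r) (h i + r)) := by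
        rw [energyOn, lintegral_iUnion (fun _ => measurableSet_Ioc) hdisj, tsum_fintype]
        rfl
    _ ≤ energyOn p ε f (Ioc a b) := energyOn_mono <| iUnion_subset fun i =>
        Ioc_subset_Ioc (hr.left i) (hr.right i)
    _ = _ := energy_eq_energyOn_Ioc.symm

end PLaplacian

/-! ### Semiconvexity of the energy and the subgradient inequality -/

namespace PLaplacian

variable {p a b ε : ℝ}

theorem flux_zero : flux p 0 = 0 := by simp [flux]

theorem abs_flux (hp : 1 < p) (g : ℝ) : |flux p g| = |g| ^ (p - 1) := by
  rcases eq_or_ne g 0 with rfl | hg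
  · rw [flux_zero, abs_zero, Real.zero_rpow (by linarith)]
  · have : 0 < |g| := abs_pos.2 hg
    rw [flux, abs_mul, abs_of_nonneg (by positivity), show p - 1 = p - 2 + 1 by ring,
      Real.rpow_add_one this.ne']

theorem flux_mul_self (hp : 1 < p) (g : ℝ) : flux p g * g = |g| ^ p := by
  rcases eq_or_ne g 0 with rfl | hg
  · rw [flux_zero, abs_zero, Real.zero_rpow (by linarith), zero_mul]
  · have : 0 < |g| := abs_pos.2 hg
    have h2 : |g| ^ p = |g| ^ (p - 2) * |g| ^ (2 : ℝ) := by
      rw [← Real.rpow_add this]; ring_nf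
    rw [flux, h2, Real.rpow_two, sq_abs]
    ring

theorem abs_le_of_abs_flux_le (hp : 1 < p) {g C : ℝ} (h : |flux p g| ≤ C) :
    |g| ≤ C ^ (1 / (p - 1)) := by
  have h1 : 0 < p - 1 := by linarith
  rw [abs_flux hp] at h
  have := Real.rpow_le_rpow (by positivity) h (z := 1 / (p - 1)) (by positivity)
  rwa [← Real.rpow_mul (abs_nonneg _), mul_one_div_cancel h1.ne', Real.rpow_one] at this

/-- Convexity of `g ↦ |g|^p / p`. -/
theorem abs_rpow_div_ge (hp : 1 < p) (g q : ℝ) :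
    |g| ^ p / p + flux p g * (q - g) ≤ |q| ^ p / p := by
  have h1 : 0 < p - 1 := by linarith
  have h0 : 0 < p := by linarith
  have hc : p.HolderConjugate (p / (p - 1)) := Real.HolderConjugate.conjExponent hp
  -- Young's inequality for `q` and `flux p g` is an equality at `q = g`, hence gives the tangent
  -- inequality.
  have hy := Real.young_inequality q (flux p g) hc
  rw [abs_flux hp, ← Real.rpow_mul (abs_nonneg _), mul_div_cancel₀ _ h1.ne'] at hy
  have e : |g| ^ p / (p / (p - 1)) = |g| ^ p - |g| ^ p / p := by field_simp
  rw [e] at hy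
  have := flux_mul_self hp g
  linarith

theorem hasDerivAt_potential (hp : 1 < p) (s : ℝ) :
    HasDerivAt (potential p) (flux p (s ^ 2 - 1) * s) s := by
  have h1 : HasDerivAt (fun s : ℝ => s ^ 2 - 1) (2 * s) s := by
    simpa using (hasDerivAt_pow 2 s).sub_const 1
  have h2 := ((hasDerivAt_abs_rpow (s ^ 2 - 1) hp).comp s h1).div_const (2 * p)
  refine h2.congr_deriv ?_
  have : p ≠ 0 := by linarith
  unfold flux
  field_simp

theorem continuous_flux (hp : 1 < p) : Continuous (flux p) := by
  refine continuous_iff_continuousAt.2 fun g => ?_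
  rcases eq_or_ne g 0 with rfl | hg
  · rw [ContinuousAt, flux_zero, tendsto_zero_iff_abs_tendsto_zero]
    have : (abs ∘ flux p) = fun g => |g| ^ (p - 1) := funext fun g => abs_flux hp g
    rw [this]
    have hc : Continuous fun g : ℝ => |g| ^ (p - 1) :=
      Continuous.rpow_const (by fun_prop) fun _ => Or.inr (by linarith)
    have := hc.tendsto 0
    rwa [abs_zero, Real.zero_rpow (by linarith)] at this
  · unfold flux
    exact (continuous_abs.continuousAt.rpow_const (Or.inl (abs_ne_zero.2 hg))).mul continuousAt_id

theorem continuous_deriv_potential (hp : 1 < p) : Continuous (deriv (potential p)) := by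
  have : deriv (potential p) = fun s => flux p (s ^ 2 - 1) * s :=
    funext fun s => (hasDerivAt_potential hp s).deriv
  rw [this]
  exact ((continuous_flux hp).comp (by fun_prop)).mul continuous_id

/-- Semiconvexity of the potential. -/
theorem potential_semiconvex (hp : 1 < p) (s t : ℝ) :
    potential p s + deriv (potential p) s * (t - s) - 1 / 2 * (t - s) ^ 2 ≤ potential p t := by
  have h0 : 0 < p := by linarith
  have hc := abs_rpow_div_ge hp (s ^ 2 - 1) (t ^ 2 - 1)
  -- Since `s² - 1 ≥ -1`, the flux is at least `-1`. It multiplies the quadratic part of `t² - s² =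
  -- 2s(t - s) + (t - s)²`, the only obstruction to convexity.
  have hfl : -1 ≤ flux p (s ^ 2 - 1) := by
    rcases le_total 0 (s ^ 2 - 1) with h | h
    · have : 0 ≤ flux p (s ^ 2 - 1) := by unfold flux; positivity
      linarith
    · have h1 : |s ^ 2 - 1| ≤ 1 := abs_le.2 ⟨by nlinarith, by linarith⟩
      have h2 := Real.rpow_le_one (abs_nonneg _) h1 (show 0 ≤ p - 1 by linarith)
      rw [← abs_flux hp] at h2
      exact (abs_le.1 h2).1
  rw [(hasDerivAt_potential hp s).deriv]
  have e1 : potential p s = |s ^ 2 - 1| ^ p / p / 2 := by unfold potential; field_simp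
  have e2 : potential p t = |t ^ 2 - 1| ^ p / p / 2 := by unfold potential; field_simp
  rw [e1, e2]
  nlinarith [mul_nonneg (by linarith : 0 ≤ flux p (s ^ 2 - 1) + 1) (sq_nonneg (t - s))]

theorem energy_density_nonneg (hp : 1 < p) (hε : 0 < ε) (g s : ℝ) :
    0 ≤ ε ^ (p - 1) * |g| ^ p / p + potential p s / ε := by
  have := potential_nonneg hp s
  positivity

/-- Tangent inequality for the energy density. -/
theorem energy_density_ge (hp : 1 < p) (hε : 0 < ε) (g q s t : ℝ) :
    (ε ^ (p - 1) * |g| ^ p / p + potential p s / ε)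
      + ε⁻¹ * (ε ^ p * (flux p g * (q - g)) + deriv (potential p) s * (t - s)
        - 1 / 2 * (t - s) ^ 2) ≤ ε ^ (p - 1) * |q| ^ p / p + potential p t / ε := by
  have h1 := mul_le_mul_of_nonneg_left (abs_rpow_div_ge hp g q)
    (show 0 ≤ ε ^ (p - 1) by positivity)
  have h2 := mul_le_mul_of_nonneg_left (potential_semiconvex hp s t) (inv_pos.2 hε).le
  have e : ε⁻¹ * ε ^ p = ε ^ (p - 1) := by
    rw [Real.rpow_sub_one hε.ne']; field_simp
  rw [mul_sub, mul_add, ← mul_assoc, e]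
  simp only [div_eq_mul_inv] at *
  linarith

theorem aestronglyMeasurable_energy_density (hp : 1 < p) (hab : a ≤ b) {f : ℝ → ℝ}
    (hf : AbsolutelyContinuousOnInterval f a b) :
    AEStronglyMeasurable (fun x => ε ^ (p - 1) * |deriv f x| ^ p / p + potential p (f x) / ε)
      (volume.restrict (Ioo a b)) := by
  have h1 : Measurable fun x => ε ^ (p - 1) * |deriv f x| ^ p / p := by
    have : Measurable fun x => |deriv f x| := (measurable_deriv f).abs
    fun_prop
  have h2 : ContinuousOn (fun x => potential p (f x) / ε) (Ioo a b) := by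
    refine ((continuous_potential hp).comp_continuousOn (hf.continuousOn.mono ?_)).div_const _
    rw [uIcc_of_le hab]
    exact Ioo_subset_Icc_self
  exact h1.aestronglyMeasurable.add (h2.aestronglyMeasurable measurableSet_Ioo)

theorem energy_toReal (hp : 1 < p) (hε : 0 < ε) (hab : a ≤ b) {f : ℝ → ℝ}
    (hf : AbsolutelyContinuousOnInterval f a b) :
    (energy p a b ε f).toReal
      = ∫ x in Ioo a b, (ε ^ (p - 1) * |deriv f x| ^ p / p + potential p (f x) / ε) := by
  rw [integral_eq_lintegral_of_nonneg_ae (ae_of_all _ fun x => energy_density_nonneg hp hε _ _)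
    (aestronglyMeasurable_energy_density hp hab hf)]
  rfl

theorem integrableOn_energy_density (hp : 1 < p) (hε : 0 < ε) (hab : a ≤ b) {f : ℝ → ℝ}
    (hf : AbsolutelyContinuousOnInterval f a b) (hfin : energy p a b ε f ≠ ⊤) :
    IntegrableOn (fun x => ε ^ (p - 1) * |deriv f x| ^ p / p + potential p (f x) / ε)
      (Ioo a b) := by
  refine ⟨aestronglyMeasurable_energy_density hp hab hf, ?_⟩
  rw [hasFiniteIntegral_iff_ofReal (ae_of_all _ fun x => energy_density_nonneg hp hε _ _)]
  exact hfin.lt_top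

theorem deriv_eq_derivWithin_Icc {f : ℝ → ℝ} {x : ℝ} (hx : x ∈ Ioo a b) :
    deriv f x = derivWithin f (Icc a b) x :=
  (derivWithin_of_mem_nhds (Icc_mem_nhds hx.1 hx.2)).symm

/-- A function with bounded flux is absolutely continuous with finite energy. -/
theorem regular_of_flux (hp : 1 < p) (hε : 0 < ε) (hab : a < b) {φ : ℝ → ℝ}
    (hd : DifferentiableOn ℝ φ (Icc a b))
    (hfl : AbsolutelyContinuousOnInterval (fun x => flux p (derivWithin φ (Icc a b) x)) a b) :
    AbsolutelyContinuousOnInterval φ a b ∧ energy p a b ε φ ≠ ⊤ := by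
  obtain ⟨C, hC⟩ := hfl.exists_bound
  rw [uIcc_of_le hab.le] at hC
  set M := C ^ (1 / (p - 1)) with hM
  have hB : ∀ x ∈ Icc a b, |derivWithin φ (Icc a b) x| ≤ M := fun x hx =>
    abs_le_of_abs_flux_le hp (hC x hx)
  have hAC : AbsolutelyContinuousOnInterval φ a b := by
    have hL : LipschitzOnWith (Real.toNNReal M) φ (uIcc a b) := by
      rw [uIcc_of_le hab.le]
      refine (convex_Icc a b).lipschitzOnWith_of_nnnorm_derivWithin_le hd fun x hx => ?_
      rw [← NNReal.coe_le_coe, coe_nnnorm]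
      exact (hB x hx).trans (Real.le_coe_toNNReal M)
    exact hL.absolutelyContinuousOnInterval
  refine ⟨hAC, ?_⟩
  obtain ⟨D, hD⟩ := (isCompact_Icc (a := a) (b := b)).exists_bound_of_continuousOn
    (f := fun x => potential p (φ x)) ((continuous_potential hp).comp_continuousOn hd.continuousOn)
  have hle : energy p a b ε φ ≤ ∫⁻ _ in Ioo a b, ENNReal.ofReal (ε ^ (p - 1) * M ^ p / p + D / ε) := by
    refine setLIntegral_mono' measurableSet_Ioo fun x hx => ENNReal.ofReal_le_ofReal ?_
    have hx' := Ioo_subset_Icc_self hx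
    rw [deriv_eq_derivWithin_Icc hx]
    have h1 := hB x hx'
    have h2 := (le_abs_self _).trans (hD x hx')
    have h3 : 0 ≤ p := by linarith
    gcongr
  refine (hle.trans_lt ?_).ne
  rw [setLIntegral_const]
  exact ENNReal.mul_lt_top ENNReal.ofReal_lt_top (by simp)

/-- Solution slices are "subgradients" of the semiconvex energy. -/
theorem energy_sub_le (hp : 1 < p) (hε : 0 < ε) (hab : a < b) {φ ψ g : ℝ → ℝ}
    (hd : DifferentiableOn ℝ φ (Icc a b))
    (hda : derivWithin φ (Icc a b) a = 0) (hdb : derivWithin φ (Icc a b) b = 0)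
    (hfl : AbsolutelyContinuousOnInterval (fun x => flux p (derivWithin φ (Icc a b) x)) a b)
    (hg : ∀ᵐ x ∂(volume.restrict (Ioo a b)),
      g x = ε ^ p * deriv (fun y => flux p (derivWithin φ (Icc a b) y)) x
        - deriv (potential p) (φ x))
    (hψ : AbsolutelyContinuousOnInterval ψ a b) (hfin : energy p a b ε ψ ≠ ⊤) :
    ε * ((energy p a b ε φ).toReal - (energy p a b ε ψ).toReal)
      ≤ -(∫ x in Ioo a b, g x * (φ x - ψ x)) + 1 / 2 * ∫ x in Ioo a b, (φ x - ψ x) ^ 2 := by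
  obtain ⟨hφ, hφfin⟩ := regular_of_flux hp hε hab hd hfl
  set fl := fun x => flux p (derivWithin φ (Icc a b) x) with hfldef
  have hu : uIcc a b = Icc a b := uIcc_of_le hab.le
  have iφ := integrableOn_energy_density hp hε hab.le hφ hφfin
  have iψ := integrableOn_energy_density hp hε hab.le hψ hfin
  have hdiff := hψ.fun_sub hφ
  have iI : ∀ {f : ℝ → ℝ}, IntervalIntegrable f volume a b → IntegrableOn f (Ioo a b) := by
    intro f hf
    exact ((intervalIntegrable_iff_integrableOn_Ioc_of_le hab.le).1 hf).mono_set Ioo_subset_Ioc_self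
  have eI : ∀ f : ℝ → ℝ, ∫ x in a..b, f x = ∫ x in Ioo a b, f x := fun f => by
    rw [intervalIntegral.integral_of_le hab.le, integral_Ioc_eq_integral_Ioo]
  -- The boundary terms vanish because the flux of `φ` does; `ψ` needs no boundary condition.
  have hparts := hfl.integral_mul_deriv_eq_deriv_mul hdiff
  have hb0 : fl b = 0 := by simp only [hfldef, hdb, flux_zero]
  have ha0 : fl a = 0 := by simp only [hfldef, hda, flux_zero]
  rw [hb0, ha0, zero_mul, zero_mul, sub_zero, zero_sub, eI, eI] at hparts
  have i1 : IntegrableOn (fun x => fl x * deriv (fun x => ψ x - φ x) x) (Ioo a b) :=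
    iI (hdiff.intervalIntegrable_deriv.continuousOn_mul hfl.continuousOn)
  have i2 : IntegrableOn (fun x => deriv fl x * (ψ x - φ x)) (Ioo a b) :=
    iI (hfl.intervalIntegrable_deriv.mul_continuousOn hdiff.continuousOn)
  have i3 : IntegrableOn (fun x => deriv (potential p) (φ x) * (ψ x - φ x)) (Ioo a b) := by
    refine iI (ContinuousOn.intervalIntegrable ?_)
    exact ((continuous_deriv_potential hp).comp_continuousOn hφ.continuousOn).mul hdiff.continuousOn
  have i4 : IntegrableOn (fun x => (ψ x - φ x) ^ 2) (Ioo a b) :=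
    iI (ContinuousOn.intervalIntegrable (hdiff.continuousOn.pow 2))
  have hpt : ∀ᵐ x ∂(volume.restrict (Ioo a b)),
      ε⁻¹ * (ε ^ p * (fl x * deriv (fun x => ψ x - φ x) x)
        + deriv (potential p) (φ x) * (ψ x - φ x) - 1 / 2 * (ψ x - φ x) ^ 2)
      ≤ (ε ^ (p - 1) * |deriv ψ x| ^ p / p + potential p (ψ x) / ε)
        - (ε ^ (p - 1) * |deriv φ x| ^ p / p + potential p (φ x) / ε) := by
    filter_upwards [ae_restrict_of_ae hψ.ae_differentiableAt, ae_restrict_mem measurableSet_Ioo]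
      with x hx hxm
    have hxm' : x ∈ uIcc a b := by rw [hu]; exact Ioo_subset_Icc_self hxm
    have hφx : DifferentiableAt ℝ φ x :=
      (hd x (Ioo_subset_Icc_self hxm)).differentiableAt (Icc_mem_nhds hxm.1 hxm.2)
    have e1 : deriv (fun x => ψ x - φ x) x = deriv ψ x - deriv φ x := deriv_fun_sub (hx hxm') hφx
    have e2 : fl x = flux p (deriv φ x) := by
      simp only [hfldef, deriv_eq_derivWithin_Icc hxm]
    have := energy_density_ge hp hε (deriv φ x) (deriv ψ x) (φ x) (ψ x)
    rw [e1, e2]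
    linarith
  have hint := integral_mono_ae
    ((((i1.const_mul (ε ^ p)).add i3).sub (i4.const_mul (1 / 2))).const_mul ε⁻¹) (iψ.sub iφ) hpt
  have eR : ∫ x in Ioo a b, ((ε ^ (p - 1) * |deriv ψ x| ^ p / p + potential p (ψ x) / ε)
        - (ε ^ (p - 1) * |deriv φ x| ^ p / p + potential p (φ x) / ε))
      = (energy p a b ε ψ).toReal - (energy p a b ε φ).toReal := by
    rw [energy_toReal hp hε hab.le hφ, energy_toReal hp hε hab.le hψ, integral_sub iψ iφ]
  have eL : ∫ x in Ioo a b, ε⁻¹ * (ε ^ p * (fl x * deriv (fun x => ψ x - φ x) x)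
        + deriv (potential p) (φ x) * (ψ x - φ x) - 1 / 2 * (ψ x - φ x) ^ 2)
      = ε⁻¹ * (ε ^ p * (∫ x in Ioo a b, fl x * deriv (fun x => ψ x - φ x) x)
        + (∫ x in Ioo a b, deriv (potential p) (φ x) * (ψ x - φ x))
        - 1 / 2 * ∫ x in Ioo a b, (ψ x - φ x) ^ 2) := by
    have i13 : IntegrableOn (fun x => ε ^ p * (fl x * deriv (fun x => ψ x - φ x) x)
        + deriv (potential p) (φ x) * (ψ x - φ x)) (Ioo a b) := (i1.const_mul _).add i3
    rw [integral_const_mul, integral_sub i13 (i4.const_mul _),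
      integral_add (i1.const_mul _) i3, integral_const_mul, integral_const_mul]
  have eg : ∫ x in Ioo a b, g x * (φ x - ψ x)
      = -(ε ^ p * ∫ x in Ioo a b, deriv fl x * (ψ x - φ x))
        + ∫ x in Ioo a b, deriv (potential p) (φ x) * (ψ x - φ x) := by
    have i5 : IntegrableOn (fun x => -(ε ^ p * (deriv fl x * (ψ x - φ x)))) (Ioo a b) :=
      (i2.const_mul _).neg
    rw [← integral_const_mul, ← integral_neg, ← integral_add i5 i3]
    refine integral_congr_ae ?_
    filter_upwards [hg] with x hx
    rw [hx]
    ring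
  have es : ∫ x in Ioo a b, (φ x - ψ x) ^ 2 = ∫ x in Ioo a b, (ψ x - φ x) ^ 2 := by
    congr 1
    ext x
    ring
  have hint' := hint.trans_eq eR
  replace hint' := eL.symm.le.trans hint'
  rw [inv_mul_le_iff₀ hε] at hint'
  rw [eg, es]
  rw [hparts] at hint'
  linarith

end PLaplacian

/-! ### Averaged telescoping and time correlations -/

/-- The Cauchy–Schwarz inequality for the integral of a square integrable function on a finite
measure space. -/
theorem MeasureTheory.MemLp.sq_integral_le {α : Type*} [MeasurableSpace α] {μ : Measure α}
    [IsFiniteMeasure μ] {g : α → ℝ} (hg : MemLp g 2 μ) :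
    (∫ x, g x ∂μ) ^ 2 ≤ μ.real univ * ∫ x, g x ^ 2 ∂μ := by
  have hi : Integrable g μ := hg.integrable (by norm_num)
  have hi2 : Integrable (fun x => g x ^ 2) μ := hg.integrable_sq
  set m := μ.real univ with hm
  set I := ∫ x, g x ∂μ with hI
  -- Cauchy–Schwarz as nonnegativity of a variance, scaled by `m` to avoid division.
  have hexp : ∫ x, (m * g x - I) ^ 2 ∂μ = m * (m * ∫ x, g x ^ 2 ∂μ - I ^ 2) := by
    have e : ∀ x, (m * g x - I) ^ 2 = m ^ 2 * g x ^ 2 - 2 * m * I * g x + I ^ 2 := fun x => by ring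
    have i12 : Integrable (fun x => m ^ 2 * g x ^ 2 - 2 * m * I * g x) μ :=
      (hi2.const_mul _).sub (hi.const_mul _)
    simp only [e]
    rw [integral_add i12 (integrable_const _), integral_sub (hi2.const_mul _) (hi.const_mul _),
      integral_const_mul, integral_const_mul, integral_const, smul_eq_mul, ← hI, ← hm]
    ring
  have h0 : 0 ≤ ∫ x, (m * g x - I) ^ 2 ∂μ := integral_nonneg fun x => sq_nonneg _
  rw [hexp] at h0
  have hm0 : 0 ≤ m := measureReal_nonneg
  rcases hm0.eq_or_lt with h | h
  · have : μ = 0 := by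
      rw [← Measure.measure_univ_eq_zero]
      exact (measureReal_eq_zero_iff).1 h.symm
    simp [hI, this]
  · nlinarith [nonneg_of_mul_nonneg_right h0 h]

/-- Telescoping along a uniform time grid, averaged over the position of the grid. -/
theorem telescope_le_integral {e R : ℝ → ℝ} {e₀ M τ : ℝ} {n : ℕ} (hτ : 0 < τ) (hn : 0 < n)
    (hR : Integrable R)
    (hstep : ∀ᵐ t, t ∈ Ioo 0 (n * τ) → e t - (if t ≤ τ then e₀ else e (t - τ)) ≤ R t)
    (hM : ∀ᵐ t, t ∈ Ioo 0 (n * τ) → M ≤ e t) :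
    τ * (M - e₀) ≤ ∫ t in (0 : ℝ)..n * τ, R t := by
  -- A fixed grid might meet the exceptional null set; almost every offset `s` avoids it at all grid
  -- points at once.
  have hshift : ∀ {P : ℝ → Prop}, (∀ᵐ t, P t) → ∀ᵐ s, ∀ j : ℕ, P (s + j * τ) := by
    intro P hP
    rw [ae_all_iff]
    intro j
    exact (measurePreserving_add_right volume ((j : ℝ) * τ)).quasiMeasurePreserving.ae hP
  have hsum : ∀ᵐ s, s ∈ Ioo 0 τ → M - e₀ ≤ ∑ j ∈ Finset.range n, R (s + j * τ) := by
    filter_upwards [hshift hstep, hshift hM] with s h1 h2 hs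
    have key : ∀ k : ℕ, k < n → e (s + k * τ) - e₀ ≤ ∑ j ∈ Finset.range (k + 1), R (s + j * τ) := by
      intro k
      induction k with
      | zero =>
        intro _
        have hn1 : (1 : ℝ) ≤ n := by exact_mod_cast hn
        have := h1 0 ⟨by simpa using hs.1, by simp; nlinarith [hs.2]⟩
        rw [if_pos (by simpa using hs.2.le)] at this
        simpa using this
      | succ k ih =>
        intro hk
        have hkn : ((k + 1 : ℕ) : ℝ) + 1 ≤ n := by exact_mod_cast hk
        have hk0 : (0 : ℝ) ≤ k := Nat.cast_nonneg k
        have := h1 (k + 1) ⟨by push_cast; nlinarith [hs.1], by nlinarith [hs.2]⟩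
        rw [if_neg (by push_cast; nlinarith [hs.1]),
          show s + ((k + 1 : ℕ) : ℝ) * τ - τ = s + k * τ by push_cast; ring] at this
        rw [Finset.sum_range_succ]
        linarith [ih (by omega)]
    obtain ⟨m, rfl⟩ : ∃ m, n = m + 1 := ⟨n - 1, by omega⟩
    have hm0 : (0 : ℝ) ≤ m := Nat.cast_nonneg m
    have := h2 m ⟨by nlinarith [hs.1], by push_cast; nlinarith [hs.2]⟩
    linarith [key m (by omega)]
  have hRi : ∀ x y, IntervalIntegrable R volume x y := fun x y => hR.intervalIntegrable
  have hsplit : ∫ t in (0 : ℝ)..n * τ, R t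
      = ∫ s in (0 : ℝ)..τ, ∑ j ∈ Finset.range n, R (s + j * τ) := by
    rw [intervalIntegral.integral_finsetSum
      fun (j : ℕ) _ => (hR.comp_add_right ((j : ℝ) * τ)).intervalIntegrable]
    have := intervalIntegral.sum_integral_adjacent_intervals (f := R) (μ := volume)
      (a := fun j : ℕ => (j : ℝ) * τ) (n := n) fun k _ => hRi _ _
    simp only [Nat.cast_zero, zero_mul] at this
    rw [← this]
    refine Finset.sum_congr rfl fun j _ => ?_
    rw [intervalIntegral.integral_comp_add_right]
    congr 1
    · ring
    · push_cast; ring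
  rw [hsplit]
  have hc : τ * (M - e₀) = ∫ _ in (0 : ℝ)..τ, (M - e₀) := by
    rw [intervalIntegral.integral_const, sub_zero, smul_eq_mul]
  rw [hc, intervalIntegral.integral_of_le hτ.le, intervalIntegral.integral_of_le hτ.le,
    integral_Ioc_eq_integral_Ioo, integral_Ioc_eq_integral_Ioo]
  refine setIntegral_mono_on_ae (by simp) ?_ measurableSet_Ioo hsum
  exact (integrable_finsetSum _ fun (j : ℕ) _ => hR.comp_add_right ((j : ℝ) * τ)).integrableOn

section Correlation

variable {f : ℝ × ℝ → ℝ}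

theorem timeShift_eq_sub (σ : ℝ) (z : ℝ × ℝ) : (z.1 - σ, z.2) = z - (σ, 0) := by
  simp [Prod.ext_iff]

theorem measurePreserving_timeShift (σ : ℝ) :
    MeasurePreserving (fun z : ℝ × ℝ => (z.1 - σ, z.2)) volume volume := by
  simp only [timeShift_eq_sub]
  exact measurePreserving_sub_right (volume : Measure (ℝ × ℝ)) (σ, 0)

theorem integral_timeShift (F : ℝ × ℝ → ℝ) (σ : ℝ) : ∫ z : ℝ × ℝ, F (z.1 - σ, z.2) = ∫ z, F z := by
  simp only [timeShift_eq_sub]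
  exact integral_sub_right_eq_self F ((σ, 0) : ℝ × ℝ)

/-- The correlation of `f` with its time translates is continuous at `0`. -/
theorem tendsto_correlation (hf : MemLp f 2) :
    Tendsto (fun σ => ∫ z, f z * f (z.1 - σ, z.2)) (𝓝 0) (𝓝 (∫ z, f z ^ 2)) := by
  -- Currying turns the translations into a continuous family of maps, so that their action on `L²`
  -- is strongly continuous.
  let g : ℝ → C(ℝ × ℝ, ℝ × ℝ) :=
    (ContinuousMap.mk (fun w : ℝ × ℝ × ℝ => (w.2.1 - w.1, w.2.2)) (by fun_prop)).curry
  have hg : Continuous g := ContinuousMap.continuous _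
  have hcont : Continuous fun σ =>
      Lp.compMeasurePreserving (g σ) (measurePreserving_timeShift σ) (hf.toLp f) :=
    continuous_const.compMeasurePreservingLp hg measurePreserving_timeShift (by norm_num)
  have hinner : Continuous fun σ => inner ℝ
      (Lp.compMeasurePreserving (g σ) (measurePreserving_timeShift σ) (hf.toLp f)) (hf.toLp f) :=
    hcont.inner continuous_const
  have heq : ∀ σ, inner ℝ
      (Lp.compMeasurePreserving (g σ) (measurePreserving_timeShift σ) (hf.toLp f)) (hf.toLp f)
      = ∫ z, f z * f (z.1 - σ, z.2) := by
    intro σ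
    rw [L2.inner_def]
    refine integral_congr_ae ?_
    filter_upwards [hf.coeFn_toLp, Lp.coeFn_compMeasurePreserving (hf.toLp f)
      (measurePreserving_timeShift σ),
      (measurePreserving_timeShift σ).quasiMeasurePreserving.ae hf.coeFn_toLp] with z h1 h2 h3
    change inner ℝ ((Lp.compMeasurePreserving (fun z : ℝ × ℝ => (z.1 - σ, z.2))
      (measurePreserving_timeShift σ) (hf.toLp f)) z) ((hf.toLp f) z) = _
    rw [h1, h2, Function.comp_apply, h3]
    rfl
  have h0 : ∫ z, f z ^ 2 = ∫ z, f z * f (z.1 - 0, z.2) := by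
    simp [sq]
  rw [h0]
  simp only [heq] at hinner
  exact hinner.tendsto 0

variable (f) in
/-- The time average `∫_0^τ f(t-σ,x) dσ`. -/
noncomputable def timeWindow (τ : ℝ) (z : ℝ × ℝ) : ℝ := ∫ σ in (0 : ℝ)..τ, f (z.1 - σ, z.2)

theorem integrable_sq_timeShift (hm : Measurable f) (hf : MemLp f 2) (τ : ℝ) :
    Integrable (fun w : (ℝ × ℝ) × ℝ => f (w.1.1 - w.2, w.1.2) ^ 2)
      (volume.prod (volume.restrict (Ioc 0 τ))) := by
  have hsq := hf.integrable_sq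
  have hinv : ∀ σ : ℝ, ∫ z : ℝ × ℝ, ‖f (z.1 - σ, z.2) ^ 2‖ = ∫ z, ‖f z ^ 2‖ := fun σ =>
    integral_timeShift (fun z => ‖f z ^ 2‖) σ
  have hmeas : Measurable fun w : (ℝ × ℝ) × ℝ => f (w.1.1 - w.2, w.1.2) ^ 2 :=
    (hm.comp (by fun_prop)).pow_const 2
  rw [integrable_prod_iff' hmeas.aestronglyMeasurable]
  refine ⟨ae_of_all _ fun σ => (measurePreserving_timeShift σ).integrable_comp_of_integrable hsq, ?_⟩
  simp only [hinv]
  exact integrable_const _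

theorem integrable_mul_timeShift (hm : Measurable f) (hf : MemLp f 2) (τ : ℝ) :
    Integrable (fun w : (ℝ × ℝ) × ℝ => f w.1 * f (w.1.1 - w.2, w.1.2))
      (volume.prod (volume.restrict (Ioc 0 τ))) := by
  have h1 := integrable_sq_timeShift hm hf τ
  have h2 := hf.integrable_sq.comp_fst (volume.restrict (Ioc 0 τ))
  have hmeas : Measurable fun w : (ℝ × ℝ) × ℝ => f w.1 * f (w.1.1 - w.2, w.1.2) :=
    (hm.comp (by fun_prop)).mul (hm.comp (by fun_prop))
  refine (h2.add h1).mono' hmeas.aestronglyMeasurable (ae_of_all _ fun w => ?_)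
  rw [Real.norm_eq_abs, abs_le]
  simp only [Pi.add_apply]
  constructor <;>
  nlinarith [sq_nonneg (f w.1 + f (w.1.1 - w.2, w.1.2)), sq_nonneg (f w.1 - f (w.1.1 - w.2, w.1.2)),
    sq_nonneg (f w.1), sq_nonneg (f (w.1.1 - w.2, w.1.2))]

theorem timeWindow_eq {τ : ℝ} (hτ : 0 ≤ τ) (z : ℝ × ℝ) :
    timeWindow f τ z = ∫ σ in Ioc 0 τ, f (z.1 - σ, z.2) :=
  intervalIntegral.integral_of_le hτ

theorem integrable_mul_timeWindow (hm : Measurable f) (hf : MemLp f 2) {τ : ℝ} (hτ : 0 ≤ τ) :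
    Integrable (fun z => f z * timeWindow f τ z) := by
  simpa only [timeWindow_eq hτ, integral_const_mul] using
    (integrable_mul_timeShift hm hf τ).integral_prod_left

theorem intervalIntegrable_correlation (hm : Measurable f) (hf : MemLp f 2) {τ : ℝ} (hτ : 0 ≤ τ) :
    IntervalIntegrable (fun σ => ∫ z, f z * f (z.1 - σ, z.2)) volume 0 τ := by
  rw [intervalIntegrable_iff_integrableOn_Ioc_of_le hτ]
  exact (integrable_mul_timeShift hm hf τ).integral_prod_right

/-- By Fubini the linear term of the one-step inequality is a time integral of correlations; divided
by `τ` it tends to `∫ f²`. -/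
theorem integral_mul_timeWindow (hm : Measurable f) (hf : MemLp f 2) {τ : ℝ} (hτ : 0 ≤ τ) :
    ∫ z, f z * timeWindow f τ z = ∫ σ in (0 : ℝ)..τ, ∫ z, f z * f (z.1 - σ, z.2) := by
  simp only [timeWindow_eq hτ, ← integral_const_mul, intervalIntegral.integral_of_le hτ]
  exact integral_integral_swap (integrable_mul_timeShift hm hf τ)

theorem sq_timeWindow_le (hm : Measurable f) (hf : MemLp f 2) {τ : ℝ} (hτ : 0 ≤ τ) :
    ∀ᵐ z, timeWindow f τ z ^ 2 ≤ τ * ∫ σ in Ioc 0 τ, f (z.1 - σ, z.2) ^ 2 := by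
  filter_upwards [(integrable_sq_timeShift hm hf τ).prod_right_ae] with z hz
  have hmz : Measurable fun σ => f (z.1 - σ, z.2) := hm.comp (by fun_prop)
  have := ((memLp_two_iff_integrable_sq hmz.aestronglyMeasurable).2 hz).sq_integral_le
  rw [timeWindow_eq hτ]
  simpa [measureReal_def, hτ] using this

theorem measurable_timeWindow (hm : Measurable f) {τ : ℝ} (hτ : 0 ≤ τ) :
    Measurable (timeWindow f τ) := by
  have hmeas : StronglyMeasurable fun w : (ℝ × ℝ) × ℝ => f (w.1.1 - w.2, w.1.2) :=
    (hm.comp (by fun_prop)).stronglyMeasurable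
  have := (hmeas.integral_prod_right' (ν := volume.restrict (Ioc 0 τ))).measurable
  simpa only [← timeWindow_eq hτ] using this

theorem integrable_sq_timeWindow (hm : Measurable f) (hf : MemLp f 2) {τ : ℝ} (hτ : 0 ≤ τ) :
    Integrable (fun z => timeWindow f τ z ^ 2) := by
  refine ((integrable_sq_timeShift hm hf τ).integral_prod_left.const_mul τ).mono'
    ((measurable_timeWindow hm hτ).pow_const 2).aestronglyMeasurable ?_
  filter_upwards [sq_timeWindow_le hm hf hτ] with z hz
  rwa [Real.norm_of_nonneg (sq_nonneg _)]

/-- The semiconvexity error is of order `τ²`, one order below the linear term, and so disappears in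
the limit. -/
theorem integral_sq_timeWindow_le (hm : Measurable f) (hf : MemLp f 2) {τ : ℝ} (hτ : 0 ≤ τ) :
    ∫ z, timeWindow f τ z ^ 2 ≤ τ ^ 2 * ∫ z, f z ^ 2 := by
  have h1 := integral_mono_ae (integrable_sq_timeWindow hm hf hτ)
    ((integrable_sq_timeShift hm hf τ).integral_prod_left.const_mul τ) (sq_timeWindow_le hm hf hτ)
  refine h1.trans_eq ?_
  rw [integral_const_mul, integral_integral_swap (integrable_sq_timeShift hm hf τ)]
  have : ∀ σ : ℝ, ∫ z : ℝ × ℝ, f (z.1 - σ, z.2) ^ 2 = ∫ z, f z ^ 2 := fun σ =>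
    integral_timeShift (fun z => f z ^ 2) σ
  simp only [this]
  simp [measureReal_def, hτ]
  ring

/-- Energy dissipation from one-step inequalities with arbitrarily small steps. -/
theorem integral_sq_le_of_step (hm : Measurable f) (hf : MemLp f 2) {e : ℝ → ℝ} {e₀ M T : ℝ}
    (hT : 0 < T) (hsupp : ∀ t x, t ∉ Ioo 0 T → f (t, x) = 0)
    (hstep : ∀ τ > 0, ∀ᵐ t, t ∈ Ioo 0 T → e t - (if t ≤ τ then e₀ else e (t - τ))
      ≤ -(∫ x, f (t, x) * timeWindow f τ (t, x)) + 1 / 2 * ∫ x, timeWindow f τ (t, x) ^ 2)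
    (hM : ∀ᵐ t, t ∈ Ioo 0 T → M ≤ e t) :
    ∫ z, f z ^ 2 ≤ e₀ - M := by
  set Q := ∫ z, f z ^ 2 with hQ
  have hbound : ∀ n : ℕ, 0 < n → ∫ σ in (0 : ℝ)..T / n, (∫ z, f z * f (z.1 - σ, z.2))
      ≤ T / n * (e₀ - M) + 1 / 2 * ((T / n) ^ 2 * Q) := by
    intro n hn
    have hn' : (0 : ℝ) < n := by exact_mod_cast hn
    have hτ : 0 < T / n := by positivity
    set τ := T / n with hτdef
    have hnT : n * τ = T := by rw [hτdef]; field_simp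
    have i1 := integrable_mul_timeWindow hm hf hτ.le
    have i2 := integrable_sq_timeWindow hm hf hτ.le
    have j1 : Integrable fun t => ∫ x, f (t, x) * timeWindow f τ (t, x) := i1.integral_prod_left
    have j2 : Integrable fun t => ∫ x, timeWindow f τ (t, x) ^ 2 := i2.integral_prod_left
    have htel := telescope_le_integral (e := e) (e₀ := e₀) (M := M) hτ hn
      (j1.neg.add (j2.const_mul (1 / 2))) (by rw [hnT]; exact hstep τ hτ) (by rw [hnT]; exact hM)
    rw [hnT, intervalIntegral.integral_of_le hT.le, integral_Ioc_eq_integral_Ioo] at htel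
    have hsplit : ∫ t in Ioo 0 T, ((-fun t => ∫ x, f (t, x) * timeWindow f τ (t, x)) +
          fun t => 1 / 2 * ∫ x, timeWindow f τ (t, x) ^ 2) t
        = -(∫ t in Ioo 0 T, ∫ x, f (t, x) * timeWindow f τ (t, x))
          + 1 / 2 * ∫ t in Ioo 0 T, ∫ x, timeWindow f τ (t, x) ^ 2 := by
      rw [integral_add' j1.neg.integrableOn (j2.const_mul (1 / 2)).integrableOn,
        integral_const_mul, ← integral_neg]
      rfl
    have h1 : ∫ t in Ioo 0 T, ∫ x, f (t, x) * timeWindow f τ (t, x)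
        = ∫ z, f z * timeWindow f τ z := by
      rw [Measure.volume_eq_prod, integral_prod _ i1]
      refine setIntegral_eq_integral_of_forall_compl_eq_zero fun t ht => ?_
      simp [hsupp t _ ht]
    -- Only an inequality: the window can be nonzero shortly after time `T`.
    have h2 : ∫ t in Ioo 0 T, ∫ x, timeWindow f τ (t, x) ^ 2 ≤ ∫ z, timeWindow f τ z ^ 2 := by
      rw [Measure.volume_eq_prod, integral_prod _ i2]
      exact setIntegral_le_integral j2 (ae_of_all _ fun t => integral_nonneg fun x => sq_nonneg _)
    have h3 := integral_sq_timeWindow_le hm hf hτ.le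
    rw [hsplit, h1, integral_mul_timeWindow hm hf hτ.le] at htel
    linarith
  refine le_of_forall_pos_le_add fun η hη => ?_
  obtain ⟨δ, hδ, hcorr⟩ := Metric.tendsto_nhds_nhds.1 (tendsto_correlation hf) η hη
  have hlim : Tendsto (fun n : ℕ => T / n) atTop (𝓝 0) := tendsto_const_div_atTop_nhds_zero_nat T
  have hlim2 : Tendsto (fun n : ℕ => e₀ - M + η + 1 / 2 * (T / n * Q)) atTop
      (𝓝 (e₀ - M + η + 1 / 2 * (0 * Q))) :=
    ((hlim.mul_const Q).const_mul (1 / 2)).const_add _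
  rw [zero_mul, mul_zero, add_zero] at hlim2
  refine ge_of_tendsto hlim2 ?_
  filter_upwards [hlim.eventually (gt_mem_nhds hδ), eventually_gt_atTop 0] with n hn hn0
  have hn' : (0 : ℝ) < n := by exact_mod_cast hn0
  have hτ : 0 < T / n := by positivity
  have hb := hbound n hn0
  have hlow : ∫ _ in (0 : ℝ)..T / n, (Q - η)
      ≤ ∫ σ in (0 : ℝ)..T / n, (∫ z, f z * f (z.1 - σ, z.2)) := by
    refine intervalIntegral.integral_mono_on hτ.le (by simp)
      (intervalIntegrable_correlation hm hf hτ.le) fun σ hσ => ?_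
    have := hcorr (x := σ) (by
      rw [Real.dist_eq, sub_zero, abs_of_nonneg hσ.1]; linarith [hσ.2])
    rw [Real.dist_eq, abs_lt] at this
    linarith [this.1]
  rw [intervalIntegral.integral_const, sub_zero, smul_eq_mul] at hlow
  have : T / n * (Q - η) ≤ T / n * (e₀ - M + 1 / 2 * (T / n * Q)) := by
    refine (hlow.trans hb).trans_eq ?_
    ring
  linarith [le_of_mul_le_mul_left this hτ]

end Correlation

/-! ### Energy dissipation and `L¹` displacement of solutions -/

namespace PLaplacian

variable {p a b ε : ℝ} {u₀ : ℝ → ℝ} {u ut : ℝ → ℝ → ℝ}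

/-- The regularity in space of a solution slice, together with the equation it satisfies. -/
def IsNeumannSlice (p a b ε : ℝ) (φ g : ℝ → ℝ) : Prop :=
  DifferentiableOn ℝ φ (Icc a b) ∧ derivWithin φ (Icc a b) a = 0 ∧
    derivWithin φ (Icc a b) b = 0 ∧
    AbsolutelyContinuousOnInterval (fun x => flux p (derivWithin φ (Icc a b) x)) a b ∧
    ∀ᵐ x ∂(volume.restrict (Ioo a b)),
      g x = ε ^ p * deriv (fun y => flux p (derivWithin φ (Icc a b) y)) x
        - deriv (potential p) (φ x)

/-- A measurable representative of the time derivative, extended by zero. -/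
theorem exists_measurable_extension {T : ℝ}
    (hut : MemLp (Function.uncurry ut) 2
      ((volume.restrict (Ioo 0 T)).prod (volume.restrict (Ioo a b)))) :
    ∃ f : ℝ × ℝ → ℝ, Measurable f ∧ MemLp f 2 ∧ Integrable f ∧
      (∀ t x, t ∉ Ioo 0 T → f (t, x) = 0) ∧ (∀ t x, x ∉ Ioo a b → f (t, x) = 0) ∧
      ∀ᵐ z ∂((volume.restrict (Ioo 0 T)).prod (volume.restrict (Ioo a b))),
        Function.uncurry ut z = f z := by
  set S := Ioo 0 T ×ˢ Ioo a b with hS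
  have hSm : MeasurableSet S := measurableSet_Ioo.prod measurableSet_Ioo
  have hμ : (volume.restrict (Ioo 0 T)).prod (volume.restrict (Ioo a b))
      = (volume : Measure (ℝ × ℝ)).restrict S := by
    rw [Measure.volume_eq_prod, hS, Measure.prod_restrict]
  obtain ⟨g, hgm, hgae⟩ := hut.aestronglyMeasurable
  have hgL : MemLp g 2 ((volume.restrict (Ioo 0 T)).prod (volume.restrict (Ioo a b))) :=
    hut.ae_eq hgae
  have hgI : Integrable g ((volume.restrict (Ioo 0 T)).prod (volume.restrict (Ioo a b))) :=
    hgL.integrable (by norm_num)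
  refine ⟨S.indicator g, hgm.measurable.indicator hSm, ?_, ?_, ?_, ?_, ?_⟩
  · rw [memLp_indicator_iff_restrict hSm, ← hμ]; exact hgL
  · rw [integrable_indicator_iff hSm, IntegrableOn, ← hμ]; exact hgI
  · intro t x ht
    exact indicator_of_notMem (fun h => ht h.1) _
  · intro t x hx
    exact indicator_of_notMem (fun h => hx h.2) _
  · rw [hμ] at hgae ⊢
    filter_upwards [hgae, ae_restrict_mem hSm] with z hz hzS
    rw [hz, indicator_of_mem hzS]

/-- The energy dissipation inequality for strong solutions. -/
theorem integral_sq_timeDeriv_le (hp : 1 < p) (hε : 0 < ε) (hab : a < b)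
    (hu₀ : AbsolutelyContinuousOnInterval u₀ a b) (hfin : energy p a b ε u₀ ≠ ⊤) {T M : ℝ}
    (hT : 0 < T)
    (hut : MemLp (Function.uncurry ut) 2
      ((volume.restrict (Ioo 0 T)).prod (volume.restrict (Ioo a b))))
    (hint : ∀ t ≥ 0, ∀ᵐ x ∂(volume.restrict (Ioo a b)), u t x = u₀ x + ∫ s in (0 : ℝ)..t, ut s x)
    (hslice : ∀ᵐ t ∂(volume.restrict (Ioi (0 : ℝ))), IsNeumannSlice p a b ε (u t) (ut t))
    (hM : ∀ᵐ t, t ∈ Ioo 0 T → M ≤ (energy p a b ε (u t)).toReal) :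
    ∫ z, Function.uncurry ut z ^ 2
        ∂((volume.restrict (Ioo 0 T)).prod (volume.restrict (Ioo a b)))
      ≤ ε * ((energy p a b ε u₀).toReal - M) := by
  obtain ⟨f, hfm, hfL, hfI, hft, hfx, hfae⟩ := exists_measurable_extension hut
  have hnorm : ∫ z, Function.uncurry ut z ^ 2
        ∂((volume.restrict (Ioo 0 T)).prod (volume.restrict (Ioo a b))) = ∫ z, f z ^ 2 := by
    rw [integral_congr_ae (hfae.mono fun z hz => congrArg (· ^ 2) hz :
      (fun z => Function.uncurry ut z ^ 2) =ᵐ[_] fun z => f z ^ 2),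
      Measure.prod_restrict, ← Measure.volume_eq_prod]
    refine setIntegral_eq_integral_of_forall_compl_eq_zero fun z hz => ?_
    rw [mem_prod, not_and_or] at hz
    rcases hz with h | h
    · rw [show z = (z.1, z.2) from rfl, hft _ _ h]; norm_num
    · rw [show z = (z.1, z.2) from rfl, hfx _ _ h]; norm_num
  have hslice' : ∀ᵐ t, 0 < t → IsNeumannSlice p a b ε (u t) (ut t) :=
    (ae_restrict_iff' measurableSet_Ioi).1 hslice
  have hft_ae : ∀ᵐ t, t ∈ Ioo 0 T → ∀ᵐ x ∂(volume.restrict (Ioo a b)), ut t x = f (t, x) :=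
    (ae_restrict_iff' measurableSet_Ioo).1 (Measure.ae_ae_of_ae_prod hfae)
  have hfx_ae : ∀ᵐ x ∂(volume.restrict (Ioo a b)), ∀ᵐ s ∂(volume.restrict (Ioo 0 T)),
      ut s x = f (s, x) :=
    Measure.ae_ae_of_ae_prod (Measure.measurePreserving_swap.quasiMeasurePreserving.ae hfae)
  have hfxI : ∀ᵐ x, Integrable fun s => f (s, x) := by
    rw [Measure.volume_eq_prod] at hfI
    exact hfI.prod_left_ae
  have hrep : ∀ t ∈ Ico 0 T, ∀ᵐ x ∂(volume.restrict (Ioo a b)),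
      u t x = u₀ x + ∫ s in (0 : ℝ)..t, f (s, x) := by
    intro t ht
    filter_upwards [hint t ht.1, hfx_ae] with x hx1 hx2
    rw [hx1]
    congr 1
    refine intervalIntegral.integral_congr_ae ?_
    filter_upwards [(ae_restrict_iff' measurableSet_Ioo).1 hx2] with s hs hs'
    rw [uIoc_of_le ht.1] at hs'
    exact hs ⟨hs'.1, hs'.2.trans_lt ht.2⟩
  rw [hnorm, mul_sub]
  refine integral_sq_le_of_step hfm hfL (e := fun t => ε * (energy p a b ε (u t)).toReal) hT hft ?_ ?_
  · intro τ hτ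
    have hshift : ∀ᵐ t, 0 < t - τ → IsNeumannSlice p a b ε (u (t - τ)) (ut (t - τ)) :=
      (measurePreserving_sub_right volume τ).quasiMeasurePreserving.ae hslice'
    filter_upwards [hslice', hft_ae, hshift] with t h1 h2 h3 ht
    set ψ := if t ≤ τ then u₀ else u (t - τ) with hψdef
    have hif : (if t ≤ τ then ε * (energy p a b ε u₀).toReal
        else ε * (energy p a b ε (u (t - τ))).toReal) = ε * (energy p a b ε ψ).toReal := by
      rw [hψdef]; split_ifs <;> rfl
    have hψ : AbsolutelyContinuousOnInterval ψ a b ∧ energy p a b ε ψ ≠ ⊤ := by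
      rw [hψdef]
      split_ifs with hc
      · exact ⟨hu₀, hfin⟩
      · obtain ⟨d1, _, _, d4, _⟩ := h3 (by linarith)
        exact regular_of_flux hp hε hab d1 d4
    obtain ⟨d1, d2, d3, d4, d5⟩ := h1 ht.1
    have hsub := energy_sub_le hp hε hab d1 d2 d3 d4 d5 hψ.1 hψ.2
    have hwin : ∀ᵐ x ∂(volume.restrict (Ioo a b)), u t x - ψ x = timeWindow f τ (t, x) := by
      filter_upwards [hrep t ⟨ht.1.le, ht.2⟩, ae_restrict_of_ae hfxI,
        (if hc : t ≤ τ then ae_of_all _ fun x h => absurd hc (not_le.2 h)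
          else (hrep (t - τ) ⟨by linarith, by linarith [ht.2]⟩).mono fun x hx _ => hx :
          ∀ᵐ x ∂(volume.restrict (Ioo a b)), τ < t →
            u (t - τ) x = u₀ x + ∫ s in (0 : ℝ)..(t - τ), f (s, x))] with x hx hxI hx'
      have hW : timeWindow f τ (t, x) = ∫ s in (t - τ)..t, f (s, x) := by
        have := intervalIntegral.integral_comp_sub_left (a := 0) (b := τ) (fun s => f (s, x)) t
        rw [sub_zero] at this
        exact this
      have hadd := intervalIntegral.integral_interval_sub_left (f := fun s => f (s, x))
        (μ := volume) (a := 0) (b := t) (c := t - τ) hxI.intervalIntegrable hxI.intervalIntegrable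
      rw [hW, ← hadd, hx, hψdef]
      split_ifs with hc
      -- For `t ≤ τ` the window reaches negative times, where `f` is zero; it therefore measures the
      -- displacement from `u₀`.
      · have h0 : ∫ s in (0 : ℝ)..(t - τ), f (s, x) = 0 := by
          rw [intervalIntegral.integral_of_ge (by linarith)]
          rw [setIntegral_eq_zero_of_forall_eq_zero, neg_zero]
          intro s hs
          exact hft s x fun h => absurd h.1 (not_lt.2 hs.2)
        rw [h0]; ring
      · rw [hx' (not_le.1 hc)]; ring
    have e1 : ∫ x in Ioo a b, ut t x * (u t x - ψ x) = ∫ x, f (t, x) * timeWindow f τ (t, x) := by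
      have : ∫ x in Ioo a b, ut t x * (u t x - ψ x)
          = ∫ x in Ioo a b, f (t, x) * timeWindow f τ (t, x) := by
        refine integral_congr_ae ?_
        filter_upwards [h2 ht, hwin] with x hx1 hx2
        rw [hx1, hx2]
      rw [this]
      refine setIntegral_eq_integral_of_forall_compl_eq_zero fun x hx => ?_
      rw [hfx t x hx, zero_mul]
    have e2 : ∫ x in Ioo a b, (u t x - ψ x) ^ 2 = ∫ x, timeWindow f τ (t, x) ^ 2 := by
      have : ∫ x in Ioo a b, (u t x - ψ x) ^ 2 = ∫ x in Ioo a b, timeWindow f τ (t, x) ^ 2 := by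
        refine integral_congr_ae ?_
        filter_upwards [hwin] with x hx
        rw [hx]
      rw [this]
      refine setIntegral_eq_integral_of_forall_compl_eq_zero fun x hx => ?_
      simp [timeWindow, hfx _ x hx]
    rw [hif, ← mul_sub]
    rwa [e1, e2] at hsub
  · filter_upwards [hM] with t ht htT
    exact mul_le_mul_of_nonneg_left (ht htT) hε.le

/-- The `L¹` displacement of a solution is controlled by the space-time `L²` norm of its time
derivative. -/
theorem distL1_initial_le {t : ℝ} (hab : a < b) (ht : 0 ≤ t)
    (hut : MemLp (Function.uncurry ut) 2
      ((volume.restrict (Ioo 0 t)).prod (volume.restrict (Ioo a b))))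
    {w : ℝ → ℝ} (hw : ∀ᵐ x ∂(volume.restrict (Ioo a b)), w x = u₀ x + ∫ s in (0 : ℝ)..t, ut s x)
    (v : ℝ → ℝ) :
    distL1 a b w v ≤ ENNReal.ofReal (Real.sqrt ((b - a) * t * ∫ z, Function.uncurry ut z ^ 2
        ∂((volume.restrict (Ioo 0 t)).prod (volume.restrict (Ioo a b)))))
      + distL1 a b u₀ v := by
  set μ := (volume.restrict (Ioo 0 t)).prod (volume.restrict (Ioo a b)) with hμ
  have hI : Integrable (Function.uncurry ut) μ := hut.integrable (by norm_num)
  have hIs : Integrable (fun z : ℝ × ℝ => ut z.2 z.1)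
      ((volume.restrict (Ioo a b)).prod (volume.restrict (Ioo 0 t))) := hI.swap
  have hmeas : AEStronglyMeasurable (fun x => ∫ s in Ioo 0 t, ut s x) (volume.restrict (Ioo a b)) :=
    hIs.aestronglyMeasurable.integral_prod_right'
  have hcs : ∫ z, ‖Function.uncurry ut z‖ ∂μ
      ≤ Real.sqrt ((b - a) * t * ∫ z, Function.uncurry ut z ^ 2 ∂μ) := by
    refine Real.le_sqrt_of_sq_le ?_
    have h1 := hut.norm.sq_integral_le
    have h2 : μ.real univ = (b - a) * t := by
      rw [hμ, measureReal_def, ← univ_prod_univ, Measure.prod_prod]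
      simp [hab.le, ht, mul_comm]
    rw [h2] at h1
    simpa using h1
  have hlin : ∫⁻ x in Ioo a b, ‖∫ s in Ioo 0 t, ut s x‖ₑ
      ≤ ENNReal.ofReal (∫ z, ‖Function.uncurry ut z‖ ∂μ) := by
    rw [ofReal_integral_norm_eq_lintegral_enorm hI, hμ,
      lintegral_prod_symm _ hI.aestronglyMeasurable.enorm]
    exact lintegral_mono fun x => enorm_integral_le_lintegral_enorm _
  rw [distL1, distL1, eLpNorm_one_eq_lintegral_enorm, eLpNorm_one_eq_lintegral_enorm]
  calc ∫⁻ x in Ioo a b, ‖w x - v x‖ₑ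
      ≤ ∫⁻ x in Ioo a b, (‖∫ s in Ioo 0 t, ut s x‖ₑ + ‖u₀ x - v x‖ₑ) := by
        refine lintegral_mono_ae ?_
        filter_upwards [hw] with x hx
        rw [hx, intervalIntegral.integral_of_le ht, integral_Ioc_eq_integral_Ioo,
          show ∀ y, u₀ x + y - v x = y + (u₀ x - v x) from fun y => by ring]
        exact enorm_add_le _ _
    _ = (∫⁻ x in Ioo a b, ‖∫ s in Ioo 0 t, ut s x‖ₑ) + ∫⁻ x in Ioo a b, ‖u₀ x - v x‖ₑ :=
        lintegral_add_left' hmeas.enorm _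
    _ ≤ _ := by
        gcongr
        exact hlin.trans (ENNReal.ofReal_le_ofReal hcs)

end PLaplacian

/-! ### Continuation and conclusion -/

/-- A continuation argument: a continuous function starting at `0` that is at most `B` as long as it
is at most `D > B` stays at most `B`. -/
theorem le_of_continuousOn_of_bootstrap {z : ℝ → ℝ} {T B D : ℝ} (hT : 0 ≤ T)
    (hz : ContinuousOn z (Icc 0 T)) (h0 : z 0 = 0) (hD : 0 < D) (hBD : B < D)
    (hboot : ∀ t ∈ Icc 0 T, z t ≤ D → z t ≤ B) : z T ≤ B := by
  by_contra hc
  have hTD : D ≤ z T := by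
    by_contra hlt
    exact hc (hboot T ⟨hT, le_rfl⟩ (not_le.1 hlt).le)
  obtain ⟨t, ht, htD⟩ := intermediate_value_Icc hT hz (show D ∈ Icc (z 0) (z T) from
    ⟨by rw [h0]; exact hD.le, hTD⟩)
  have := hboot t ht htD.le
  linarith

namespace PLaplacian

variable {p a b ε : ℝ} {u₀ v : ℝ → ℝ} {u : ℝ → ℝ → ℝ}

/-- Slow motion of a single solution, given a lower bound `M` for the energy near `v`. -/
theorem IsNeumannSolution.distL1_le (hp : 1 < p) (hε : 0 < ε) (hab : a < b)
    (hsol : IsNeumannSolution p a b ε u₀ u)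
    (hu₀ : AbsolutelyContinuousOnInterval u₀ a b) (hfin : energy p a b ε u₀ ≠ ⊤)
    {δ M T B : ℝ} (hδ : 0 < δ) (hT : 0 ≤ T)
    (hlow : ∀ f : ℝ → ℝ, AbsolutelyContinuousOnInterval f a b →
      distL1 a b f v ≤ ENNReal.ofReal (δ + δ) → ENNReal.ofReal M ≤ energy p a b ε f)
    (hclose : distL1 a b u₀ v ≤ ENNReal.ofReal δ)
    (hB : Real.sqrt ((b - a) * T * (ε * ((energy p a b ε u₀).toReal - M))) ≤ B) (hBδ : B < δ) :
    ∀ t ∈ Icc 0 T, distL1 a b (u t) v ≤ ENNReal.ofReal B + distL1 a b u₀ v := by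
  obtain ⟨ut, hut, hint, hslice⟩ := hsol
  have hut' : ∀ t, MemLp (Function.uncurry ut) 2
      ((volume.restrict (Ioo 0 t)).prod (volume.restrict (Ioo a b))) := by
    intro t
    rcases lt_or_ge 0 t with h | h
    · exact hut t h
    · simp [Ioo_eq_empty (not_lt.2 h)]
  set k : ℝ → ℝ := fun s => ∫ x in Ioo a b, ut s x ^ 2 with hk
  have hk0 : ∀ s, 0 ≤ k s := fun s => integral_nonneg fun x => sq_nonneg _
  have hkI : ∀ t, IntegrableOn k (Ioo 0 t) := fun t => (hut' t).integrable_sq.integral_prod_left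
  set Z : ℝ → ℝ := fun t => ∫ s in (0 : ℝ)..t, k s with hZ
  have hZeq : ∀ t, 0 ≤ t → ∫ z, Function.uncurry ut z ^ 2
      ∂((volume.restrict (Ioo 0 t)).prod (volume.restrict (Ioo a b))) = Z t := by
    intro t ht
    rw [integral_prod _ (hut' t).integrable_sq, hZ]
    simp only [intervalIntegral.integral_of_le ht, integral_Ioc_eq_integral_Ioo]
    rfl
  have hkII : ∀ t, 0 ≤ t → IntervalIntegrable k volume 0 t := fun t ht => by
    rw [intervalIntegrable_iff_integrableOn_Ioo_of_le ht]; exact hkI t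
  have hZ0 : ∀ t, 0 ≤ t → 0 ≤ Z t := fun t ht => intervalIntegral.integral_nonneg ht fun s _ => hk0 s
  have hZmono : ∀ s t, 0 ≤ s → s ≤ t → Z s ≤ Z t := by
    intro s t hs hst
    exact intervalIntegral.integral_mono_interval le_rfl hs hst (ae_of_all _ hk0)
      (hkII t (hs.trans hst))
  have hZc : ContinuousOn Z (Icc 0 T) := by
    have := intervalIntegral.continuousOn_primitive_interval (μ := volume) (f := k) (a := 0) (b := T)
      (by rw [uIcc_of_le hT, integrableOn_Icc_iff_integrableOn_Ioo]; exact hkI T)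
    rwa [uIcc_of_le hT] at this
  -- The continuation runs on this continuous, monotone majorant of the displacement. While `z ≤ δ`,
  -- the solution is within `2δ` of `v`, so the energy bound `M` holds and dissipation improves the
  -- estimate to `z ≤ B`.
  set z : ℝ → ℝ := fun t => Real.sqrt ((b - a) * t * Z t) with hz
  have hba : 0 < b - a := sub_pos.2 hab
  have hzmono : ∀ s t, 0 ≤ s → s ≤ t → z s ≤ z t := by
    intro s t hs hst
    refine Real.sqrt_le_sqrt ?_
    have := hZmono s t hs hst
    have := hZ0 s hs
    have := hs.trans hst
    gcongr
  have hzc : ContinuousOn z (Icc 0 T) :=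
    ((continuousOn_const.mul continuousOn_id).mul hZc).sqrt
  have hdist : ∀ t, 0 ≤ t → distL1 a b (u t) v ≤ ENNReal.ofReal (z t) + distL1 a b u₀ v := by
    intro t ht
    have := distL1_initial_le hab ht (hut' t) (hint t ht) v
    rwa [hZeq t ht] at this
  have hzT : z T ≤ B := by
    refine le_of_continuousOn_of_bootstrap hT hzc (by simp [hz]) hδ hBδ fun t ht htδ => ?_
    rcases ht.1.eq_or_lt with rfl | ht0
    · refine le_trans ?_ hB
      simp [hz]
    have hMt : ∀ᵐ s, s ∈ Ioo 0 t → M ≤ (energy p a b ε (u s)).toReal := by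
      filter_upwards [(ae_restrict_iff' measurableSet_Ioi).1 hslice] with s hs hst
      obtain ⟨d1, _, _, d4, _⟩ := hs hst.1
      obtain ⟨hAC, hne⟩ := regular_of_flux hp hε hab d1 d4
      refine (ENNReal.ofReal_le_iff_le_toReal hne).1 (hlow _ hAC ?_)
      rw [ENNReal.ofReal_add hδ.le hδ.le]
      refine (hdist s hst.1.le).trans (add_le_add (ENNReal.ofReal_le_ofReal ?_) hclose)
      exact (hzmono s t hst.1.le hst.2.le).trans htδ
    have hdis := integral_sq_timeDeriv_le hp hε hab hu₀ hfin ht0 (hut' t) hint hslice hMt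
    rw [hZeq t ht.1] at hdis
    refine le_trans (Real.sqrt_le_sqrt ?_) hB
    exact mul_le_mul (mul_le_mul_of_nonneg_left ht.2 hba.le) hdis (hZ0 t ht.1) (by positivity)
  intro t ht
  refine (hdist t ht.1).trans (add_le_add (ENNReal.ofReal_le_ofReal ?_) le_rfl)
  exact (hzmono t T ht.1 ht.2).trans hzT

end PLaplacian

theorem mainTheorem1 (p a b : ℝ) (hp : 1 < p) (hab : a < b)
    (N : ℕ) (h : Fin N → ℝ) (v : ℝ → ℝ) (hv : PLaplacian.IsStepFunction a b h v)
    (r : ℝ) (hr : PLaplacian.IsSeparation a b h r)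
    (A : ℝ) (hA : A ∈ Set.Ioo 0 (r * Real.sqrt 2 * PLaplacian.lam p))
    (u₀ : ℝ → ℝ → ℝ) (u : ℝ → ℝ → ℝ → ℝ)
    (hH1 : ∀ᶠ ε in 𝓝[>] (0 : ℝ), PLaplacian.MemH1 a b (u₀ ε))
    (hclose : Tendsto (fun ε => PLaplacian.distL1 a b (u₀ ε) v) (𝓝[>] 0) (𝓝 0))
    (henergy : ∃ C : ℝ, 0 < C ∧ ∀ᶠ ε in 𝓝[>] (0 : ℝ),
      PLaplacian.energy p a b ε (u₀ ε) ≤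
        ENNReal.ofReal (N * PLaplacian.minEnergy p + C * Real.exp (-(A * p / (2 * ε)))))
    (hsol : ∀ᶠ ε in 𝓝[>] (0 : ℝ), PLaplacian.IsNeumannSolution p a b ε (u₀ ε) (u ε)) :
    ∀ m : ℝ, 0 < m →
      Tendsto
        (fun ε => ⨆ t ∈ Set.Icc 0 (m * Real.exp (A * p / (2 * ε))),
          PLaplacian.distL1 a b (u ε t) v)
        (𝓝[>] 0) (𝓝 0) := by
  intro m hm
  obtain ⟨C, hC, hen⟩ := henergy
  obtain ⟨δ, hδ, hlow⟩ := PLaplacian.exists_energy_lower_bound hp hab hv hr hA.2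
  have hba : 0 < b - a := sub_pos.2 hab
  have hmin : 0 ≤ PLaplacian.minEnergy p := by
    rw [PLaplacian.minEnergy_eq hp]
    exact sub_nonneg.2 ((PLaplacian.strictMono_mmPrimitive hp).monotone (by norm_num))
  set B : ℝ → ℝ := fun ε => Real.sqrt ((b - a) * m * (C + 2 * N) * ε) with hBdef
  have hBlim : Tendsto B (𝓝[>] 0) (𝓝 0) := by
    have : Continuous B := by fun_prop
    have := (this.tendsto 0).mono_left (nhdsWithin_le_nhds (s := Ioi 0))
    simpa [hBdef] using this
  have hlim : Tendsto (fun ε => ENNReal.ofReal (B ε) + PLaplacian.distL1 a b (u₀ ε) v)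
      (𝓝[>] 0) (𝓝 0) := by
    simpa using (ENNReal.tendsto_ofReal hBlim).add hclose
  refine tendsto_of_tendsto_of_tendsto_of_le_of_le' tendsto_const_nhds hlim
    (Eventually.of_forall fun _ => zero_le) ?_
  -- Half of the radius is for the initial distance, half for the displacement.
  have hδ2 : 0 < δ / 2 := by linarith
  filter_upwards [hH1, hen, hsol, hlow, hBlim.eventually (gt_mem_nhds hδ2), self_mem_nhdsWithin,
    hclose.eventually (gt_mem_nhds (ENNReal.ofReal_pos.2 hδ2))]
    with ε e1 e2 e3 e4 e5 hε e7
  replace hε : 0 < ε := hε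
  have hfin : PLaplacian.energy p a b ε (u₀ ε) ≠ ⊤ := (e2.trans_lt ENNReal.ofReal_lt_top).ne
  refine iSup₂_le fun t ht => ?_
  refine e3.distL1_le hp hε hab e1.1 hfin hδ2 (by positivity)
    (fun f hf hfv => e4 f hf (by rwa [add_halves] at hfv)) e7.le ?_ e5 t ht
  refine Real.sqrt_le_sqrt ?_
  have hE : (PLaplacian.energy p a b ε (u₀ ε)).toReal
      ≤ N * PLaplacian.minEnergy p + C * Real.exp (-(A * p / (2 * ε))) :=
    ENNReal.toReal_le_of_le_ofReal (by positivity) e2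
  -- The available energy is at most `(C + 2N) exp(-Ap/(2ε))`, exactly compensating the length of
  -- the time interval; the factor `ε` survives.
  calc (b - a) * (m * Real.exp (A * p / (2 * ε))) * (ε * ((PLaplacian.energy p a b ε (u₀ ε)).toReal
        - N * (PLaplacian.minEnergy p - 2 * Real.exp (-(A * p / (2 * ε))))))
      ≤ (b - a) * (m * Real.exp (A * p / (2 * ε)))
          * (ε * ((C + 2 * N) * Real.exp (-(A * p / (2 * ε))))) := by
        gcongr
        linarith
    _ = (b - a) * m * (C + 2 * N) * ε
          * (Real.exp (A * p / (2 * ε)) * Real.exp (-(A * p / (2 * ε)))) := by ring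
    _ = (b - a) * m * (C + 2 * N) * ε := by rw [← Real.exp_add, add_neg_cancel, Real.exp_zero, mul_one]
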